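/- A binary tree is a rooted tree in which every vertex has at most one left child and at most one right child; the left (right) vertices are the vertices that are left (right) children. A non-ambiguous tree (NAT) is a binary tree $B$ together with a labelling of its left vertices by $1,\dots,w$ and of its right vertices by $1,\dots,h$, where $w$ and $h$ are the numbers of left and right vertices, such that different left (resp. right) vertices have different labels, and such that if $U$ and $V$ are both left (resp. both right) vertices and $U$ is a proper ancestor of $V$, then the label of $U$ is greater than the label of $V$. The hook of a vertex $v$ is the union of $\{v\}$, the leftmost branch starting at $v$ and the rightmost branch starting at $v$. The vertices of $B$ can be partitioned in a unique way into hooks, and the hook number of $B$ is the number of hooks in this partition. Let $\alpha,\beta$ be elements of a commutative semiring (for example indeterminates over $\mathbb N$). For a non-empty NAT $T$ let $\ell(T)$ be the number of left vertices in the leftmost branch of its root and $r(T)$ the number of right vertices in the rightmost branch of its root. Let $S_{2,q}(n,k)$ be the $q$-Stirling number of the second kind, $S_{2,q}(n,k)=\sum_{\pi} q^{b(\pi)}$, where $\pi$ runs over the partitions of $\{1,\dots,n\}$ into $k$ blocks and $b(\pi)$ is the number of elements different from $1$ in the block of $\pi$ that contains $1$. Let $x^{(m)}=x(x+1)\cdots(x+m-1)$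 be the rising factorial, with $x^{(0)}=1$. **Theorem.** For all integers $w,h\ge 0$, $$\sum_{T}\alpha^{\ell(T)}\beta^{r(T)}=\sum_{p\ge 1}(p-1)!\,(\alpha+\beta)^{(p-1)}\,S_{2,\alpha}(w+1,p)\,S_{2,\beta}(h+1,p),$$ where $T$ runs over the finitely many non-empty NATs with $w$ left vertices and $h$ right vertices, and where only finitely many summands on the right are non-zero. Moreover, for every $p\ge 1$ the $p$-th summand on the right is equal to the sum of $\alpha^{\ell(T)}\beta^{r(T)}$ over those of these NATs $T$ whose hook number is $p$; in particular, for $\alpha=\beta=1$ it is the number of these NATs. -/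

import Mathlib

open Finset

namespace NonAmbiguous

/-- The two directions in which a child can hang in a binary tree. -/
inductive Side
  | left
  | right
  deriving DecidableEq

/-- A vertex of a binary tree, given by the path from the root to it (first step first);
the root is `[]`, and the child of `v` on side `s` is `v ++ [s]`. -/
abbrev Vertex := List Side

/-- The set of vertices of a binary tree. The empty binary tree is `BinaryTree.nil`. -/
def vertices : BinaryTree Unit → Finset Vertex
  | .nil => ∅
  | .node _ l r =>
      insert [] ((vertices l).image (Side.left :: ·) ∪ (vertices r).image (Side.right :: ·))

/-- The children on side `s`, i.e. the left children (left vertices) for `s = Side.left` and the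
right children (right vertices) for `s = Side.right`. -/
def children (s : Side) (B : BinaryTree Unit) : Finset Vertex :=
  (vertices B).filter fun v => v.getLast? = some s

/-- `u` is a (proper) ancestor of `v`. -/
def IsAncestor (u v : Vertex) : Prop := u <+: v ∧ u ≠ v

/-- A labelling of the children of `B` on side `s` by `1, …, n`, where `n` is the number of these
children, such that different children have different labels and labels strictly decrease from
ancestors to descendants. -/
@[ext]
structure SideLabelling (s : Side) (B : BinaryTree Unit) where
  label : children s B → Finset.Icc 1 (children s B).card
  injective : Function.Injective label
  decreasing : ∀ u v : children s B, IsAncestor u.1 v.1 → label v < label u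

/-- A non-ambiguous tree: a binary tree with labelled left children and labelled right children. -/
@[ext]
structure Tree where
  shape : BinaryTree Unit
  leftLabelling : SideLabelling Side.left shape
  rightLabelling : SideLabelling Side.right shape

/-- The branch of `v` on side `s`: the vertices of `B` reached from `v` by steps to side `s` only
(`v` included). For `s = Side.left` this is the leftmost branch of `v`, for `s = Side.right` its
rightmost branch. -/
noncomputable def branch (s : Side) (B : BinaryTree Unit) (v : Vertex) : Finset Vertex :=
  open Classical in (vertices B).filter fun x => ∃ k : ℕ, x = v ++ List.replicate k s

/-- The hook of `v`: the union of `{v}`, its leftmost branch and its rightmost branch. -/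
noncomputable def hook (B : BinaryTree Unit) (v : Vertex) : Finset Vertex :=
  {v} ∪ branch Side.left B v ∪ branch Side.right B v

/-- A partition of the vertices of `B` all of whose parts are hooks of vertices of `B`. -/
def IsHookPartition (B : BinaryTree Unit) (P : Finpartition (vertices B)) : Prop :=
  ∀ A ∈ P.parts, ∃ v ∈ vertices B, A = hook B v

theorem mem_hook {B : BinaryTree Unit} {v x : Vertex} (hv : v ∈ vertices B) :
    x ∈ hook B v ↔ x ∈ vertices B ∧ ∃ (k : ℕ) (s : Side), x = v ++ List.replicate k s := by
  simp only [hook, branch, mem_union, mem_singleton, mem_filter]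
  constructor
  · rintro ((rfl | ⟨hx, k, hk⟩) | ⟨hx, k, hk⟩)
    · exact ⟨hv, 0, Side.left, by simp⟩
    · exact ⟨hx, k, _, hk⟩
    · exact ⟨hx, k, _, hk⟩
  · rintro ⟨hx, k, s, hk⟩
    cases s
    · exact Or.inl (Or.inr ⟨hx, k, hk⟩)
    · exact Or.inr ⟨hx, k, hk⟩

theorem self_mem_hook {B : BinaryTree Unit} (v : Vertex) : v ∈ hook B v := by
  simp [hook]

theorem hook_injective {B : BinaryTree Unit} {u v : Vertex} (hu : u ∈ vertices B)
    (hv : v ∈ vertices B) (h : hook B u = hook B v) : u = v := by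
  obtain ⟨-, k, s, hk⟩ := (mem_hook hv).1 (h ▸ self_mem_hook u)
  obtain ⟨-, j, t, hj⟩ := (mem_hook hu).1 (h.symm ▸ self_mem_hook v)
  have h1 := congrArg List.length hk
  have h2 := congrArg List.length hj
  simp at h1 h2
  have : k = 0 := by omega
  subst this
  simpa using hk

/-- If two hooks meet, then the vertex of one of them lies in the other hook. -/
theorem hook_meet {B : BinaryTree Unit} {u v x : Vertex} (hu : u ∈ vertices B)
    (hv : v ∈ vertices B) (hxu : x ∈ hook B u) (hxv : x ∈ hook B v)
    (hl : u.length ≤ v.length) : v ∈ hook B u := by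
  obtain ⟨-, k, s, hk⟩ := (mem_hook hu).1 hxu
  obtain ⟨-, j, t, hj⟩ := (mem_hook hv).1 hxv
  have hp : u <+: v := List.prefix_of_prefix_length_le (l₃ := x)
    (hk ▸ List.prefix_append _ _) (hj ▸ List.prefix_append _ _) hl
  obtain ⟨r, rfl⟩ := hp
  refine (mem_hook hu).2 ⟨hv, r.length, s, ?_⟩
  rw [hk, List.append_assoc] at hj
  have hr := List.append_cancel_left hj
  have : r = List.replicate r.length s := by
    rw [List.eq_replicate_iff]
    refine ⟨rfl, fun b hb => ?_⟩
    have : b ∈ List.replicate k s := by rw [hr]; simp [hb]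
    exact List.eq_of_mem_replicate this
  rw [← this]

/-- The vertices that are not in the hook of an earlier such vertex. -/
def IsHookRoot (B : BinaryTree Unit) (x : Vertex) : Prop :=
  x ∈ vertices B ∧
    ∀ u : Vertex, u.length < x.length → IsHookRoot B u → x ∉ hook B u
termination_by x.length

/-- There is a unique way to partition the vertices of a binary tree in hooks. -/
theorem existsUnique_isHookPartition (B : BinaryTree Unit) :
    ∃! P : Finpartition (vertices B), IsHookPartition B P := by
  classical
  have hroot : ∀ x, IsHookRoot B x → x ∈ vertices B := fun x hx => by
    rw [IsHookRoot] at hx; exact hx.1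
  have meet : ∀ u v x, IsHookRoot B u → IsHookRoot B v → x ∈ hook B u → x ∈ hook B v →
      u.length ≤ v.length → u = v := by
    intro u v x hu hv hxu hxv hl
    have hm := hook_meet (hroot u hu) (hroot v hv) hxu hxv hl
    rcases lt_or_eq_of_le hl with h | h
    · rw [IsHookRoot] at hv
      exact absurd hm (hv.2 u h hu)
    · obtain ⟨-, k, s, hk⟩ := (mem_hook (hroot u hu)).1 hm
      have h1 := congrArg List.length hk
      simp at h1
      have : k = 0 := by omega
      subst this
      simpa using hk.symm
  have cover : ∀ x ∈ vertices B, ∃ u, IsHookRoot B u ∧ x ∈ hook B u := by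
    intro x hx
    by_cases h : IsHookRoot B x
    · exact ⟨x, h, self_mem_hook x⟩
    · have h' := h
      rw [IsHookRoot] at h'
      push Not at h'
      obtain ⟨u, -, h1, h2⟩ := h' hx
      exact ⟨u, h1, h2⟩
  have sub : ∀ u ∈ vertices B, hook B u ⊆ vertices B := fun u hu x hx => ((mem_hook hu).1 hx).1
  refine ⟨Finpartition.ofExistsUnique
    (((vertices B).filter (IsHookRoot B)).image (hook B)) ?_ ?_ ?_, ?_, ?_⟩
  · intro p hp
    obtain ⟨u, hu, rfl⟩ := mem_image.1 hp
    exact sub u (mem_filter.1 hu).1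
  · intro x hx
    obtain ⟨u, hu, hxu⟩ := cover x hx
    refine ⟨hook B u, ⟨mem_image_of_mem _ (mem_filter.2 ⟨hroot u hu, hu⟩), hxu⟩, ?_⟩
    rintro _ ⟨hp, hxp⟩
    obtain ⟨v, hv, rfl⟩ := mem_image.1 hp
    have hv := (mem_filter.1 hv).2
    rcases le_total u.length v.length with h | h
    · rw [meet u v x hu hv hxu hxp h]
    · rw [meet v u x hv hu hxp hxu h]
  · intro hp
    obtain ⟨v, -, hv⟩ := mem_image.1 hp
    have := self_mem_hook (B := B) v
    rw [hv] at this
    simp at this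
  · intro A hA
    obtain ⟨u, hu, rfl⟩ := mem_image.1 hA
    exact ⟨u, (mem_filter.1 hu).1, rfl⟩
  · intro P hP
    have key : ∀ n : ℕ, ∀ x ∈ vertices B, x.length = n →
        (hook B x ∈ P.parts ↔ IsHookRoot B x) := by
      intro n
      induction n using Nat.strong_induction_on with
      | _ n ih =>
        intro x hx hn
        constructor
        · intro h
          rw [IsHookRoot]
          refine ⟨hx, fun u hu hur hxu => ?_⟩
          have hub := hroot u hur
          have hup := (ih u.length (hn ▸ hu) u hub rfl).2 hur
          have := hook_injective hub hx (P.eq_of_mem_parts hup h hxu (self_mem_hook x))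
          rw [this] at hu
          exact lt_irrefl _ hu
        · intro h
          obtain ⟨A, hA, hxA⟩ := P.exists_mem hx
          obtain ⟨v, hv, rfl⟩ := hP A hA
          obtain ⟨-, k, s, hk⟩ := (mem_hook hv).1 hxA
          have h1 := congrArg List.length hk
          simp at h1
          rcases Nat.eq_zero_or_pos k with rfl | hkp
          · have : x = v := by simpa using hk
            rw [this]; exact hA
          · have hlt : v.length < x.length := by omega
            have hvr := (ih v.length (hn ▸ hlt) v hv rfl).1 hA
            rw [IsHookRoot] at h
            exact absurd hxA (h.2 v hlt hvr)
    apply Finpartition.ext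
    ext A
    simp only [Finpartition.ofExistsUnique_parts, mem_image, mem_filter]
    constructor
    · intro hA
      obtain ⟨v, hv, rfl⟩ := hP A hA
      exact ⟨v, ⟨hv, (key _ v hv rfl).1 hA⟩, rfl⟩
    · rintro ⟨v, ⟨hv, hvr⟩, rfl⟩
      exact (key _ v hv rfl).2 hvr

/-- The hook number of `B`: the number of hooks in the unique partition of its vertices in hooks. -/
noncomputable def hookNumber (B : BinaryTree Unit) : ℕ :=
  (existsUnique_isHookPartition B).choose.parts.card

/-- For `s = Side.left` the number of left vertices in the leftmost branch of the root, for
`s = Side.right` the number of right vertices in the rightmost branch of the root. -/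
noncomputable def rootBranchCount (s : Side) (B : BinaryTree Unit) : ℕ :=
  (branch s B [] ∩ children s B).card

/-- The non-empty non-ambiguous trees with `w` left vertices and `h` right vertices. -/
def treesOfSizeSet (w h : ℕ) : Set Tree :=
  {T | T.shape ≠ .nil ∧ (children Side.left T.shape).card = w ∧
    (children Side.right T.shape).card = h}

theorem vertices_card (B : BinaryTree Unit) : (vertices B).card = B.numNodes := by
  induction B with
  | nil => rfl
  | node a l r hl hr =>
    rw [vertices, card_insert_of_notMem (by simp), card_union_of_disjoint, card_image_of_injective,
      card_image_of_injective, hl, hr, BinaryTree.numNodes]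
    · exact List.cons_injective
    · exact List.cons_injective
    · rw [disjoint_left]
      intro x hx hx'
      obtain ⟨y, -, rfl⟩ := mem_image.1 hx
      obtain ⟨z, -, hz⟩ := mem_image.1 hx'
      simp at hz

theorem vertices_card_le (B : BinaryTree Unit) :
    (vertices B).card ≤ (children Side.left B).card + (children Side.right B).card + 1 := by
  have : vertices B ⊆ insert [] (children Side.left B ∪ children Side.right B) := by
    intro v hv
    rcases List.eq_nil_or_concat v with rfl | ⟨u, s, rfl⟩
    · simp
    · rw [List.concat_eq_append] at hv ⊢
      cases s <;> simp [children, hv]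
  calc _ ≤ _ := card_le_card this
    _ ≤ _ := card_insert_le _ _
    _ ≤ _ := by gcongr; exact card_union_le _ _

instance (s : Side) (B : BinaryTree Unit) : Finite (SideLabelling s B) :=
  Finite.of_injective SideLabelling.label fun _ _ => SideLabelling.ext

theorem treesOfSizeSet_finite (w h : ℕ) : (treesOfSizeSet w h).Finite := by
  let F : Finset (BinaryTree Unit) :=
    (range (w + h + 2)).biUnion BinaryTree.treesOfNumNodesEq
  let g : (Σ B : F, SideLabelling Side.left B.1 × SideLabelling Side.right B.1) → Tree :=
    fun x => ⟨x.1.1, x.2.1, x.2.2⟩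
  refine (Set.finite_range g).subset ?_
  rintro ⟨B, L, R⟩ ⟨-, hw, hh⟩
  have hB : B ∈ F := by
    have := vertices_card_le B
    rw [vertices_card] at this
    simp only at hw hh
    simp only [F, mem_biUnion, mem_range, BinaryTree.mem_treesOfNumNodesEq]
    exact ⟨_, by omega, rfl⟩
  exact ⟨⟨⟨B, hB⟩, L, R⟩, rfl⟩

/-- The finite set of non-empty non-ambiguous trees with `w` left and `h` right vertices. -/
noncomputable def treesOfSize (w h : ℕ) : Finset Tree := (treesOfSizeSet_finite w h).toFinset

/-- The weight of a non-ambiguous tree: `α` marks the left vertices in the leftmost branch of the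
root and `β` marks the right vertices in the rightmost branch of the root. -/
noncomputable def weight {R : Type*} [CommSemiring R] (α β : R) (T : Tree) : R :=
  α ^ rootBranchCount Side.left T.shape * β ^ rootBranchCount Side.right T.shape

/-- The `q`-Stirling number of the second kind `S_{2,q}(n, k)`: the sum, over the partitions of
`{1, …, n}` in `k` blocks, of `q` to the number of elements different from `1` in the block
containing `1`. -/
noncomputable def qStirling {R : Type*} [CommSemiring R] (q : R) (n k : ℕ) : R :=
  ∑ P : Finpartition (Finset.Icc 1 n) with P.parts.card = k, q ^ ((P.part 1).erase 1).card

/-- The summand `(p - 1)! · (α + β)(α + β + 1) ⋯ (α + β + p - 2) · S_{2,α}(w+1, p) S_{2,β}(h+1, p)`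
(for `p ≥ 1`). -/
noncomputable def summand {R : Type*} [CommSemiring R] (α β : R) (w h p : ℕ) : R :=
  ((p - 1).factorial : R) * (ascPochhammer R (p - 1)).eval (α + β) *
    (qStirling α (w + 1) p * qStirling β (h + 1) p)

end NonAmbiguous

/-! For a fixed shape, the left and the right labels are chosen independently, and each choice is a
decreasing labelling of a forest. Removing the root splits each forest into two mutually
incomparable pieces. Hence the number of labellings, divided by the factorials of the numbers of
left and right vertices, is multiplicative (`labelDensity_node`), and the generating series in x
(left vertices) and y (right vertices) multiply. When a tree is hung on the left, its root becomes a
left vertex whose label is forced to be the largest (`linExt_hang`), so hanging is integration in x;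
on the right it is integration in y.

Let t mark hooks. A vertex either starts a hook or continues a left or a right branch
(`hookNumber_eq`). Let L_a and R_b be the series of the possibly empty subtrees that continue a left
or right branch, with a and b marking the vertices of that branch, and let P and Q be those of left
and right subtrees that start a hook. Then ∂x L_a = a L_a Q, ∂y R_b = b P R_b and ∂x P = ∂y Q = t
L_1 R_1, where L_a and P are 1 at x = 0 and R_b and Q are 1 at y = 0. This system has only one
solution. With u = 1 / (1 - t (e^x - 1)(e^y - 1)) it gives L_a = (e^x u)^a and R_b = (e^y u)^b
(`agree_closed`).

The non-empty trees therefore have the series t e^(ax) e^(by) u^(a+b). Expand u^(a+b) in powers of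
t; since e^(ax) (e^x - 1)^m / m! is the exponential series of the numbers S_{2,a}(n+1, m+1)
(`coeff_exp_pow_mul`), the coefficient of t^p is the p-th summand. This works for natural numbers a
and b. Both sides are polynomials in α and β over ℕ, so the identity holds for indeterminates
(`sum_weight_X`) and then specialises to every commutative semiring. -/

namespace NonAmbiguous

/-! ### Counting decreasing labellings of a finite set with a relation. -/

section LinearExtensions

variable {V : Type*}

/-- Injective labellings of `S` by `1, …, |S|` that strictly decrease along `r`, extended by `0`. -/
def IsLabelling (r : V → V → Prop) (S : Finset V) (f : V → ℕ) : Prop :=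
  (∀ x, x ∉ S → f x = 0) ∧ Set.InjOn f S ∧ (∀ x ∈ S, f x ∈ Icc 1 S.card) ∧
    ∀ u ∈ S, ∀ v ∈ S, r u v → f v < f u

/-- The number of labellings of `S`. -/
noncomputable def linExt (r : V → V → Prop) (S : Finset V) : ℕ :=
  Nat.card {f : V → ℕ // IsLabelling r S f}

variable {r : V → V → Prop}

instance finite_isLabelling (S : Finset V) : Finite {f : V → ℕ // IsLabelling r S f} := by
  refine Finite.of_injective
    (β := S → Icc 1 S.card) (fun f x => ⟨f.1 x.1, f.2.2.2.1 x.1 x.2⟩) ?_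
  intro f g h
  ext x
  by_cases hx : x ∈ S
  · exact congrArg Subtype.val (congrFun h ⟨x, hx⟩)
  · rw [f.2.1 x hx, g.2.1 x hx]

theorem linExt_empty : linExt r (∅ : Finset V) = 1 := by
  have : Unique {f : V → ℕ // IsLabelling r ∅ f} :=
    { default := ⟨fun _ => 0, by simp [IsLabelling]⟩
      uniq := fun f => by
        ext x
        exact f.2.1 x (by simp) }
  exact Nat.card_unique

theorem IsLabelling.image {S : Finset V} {f : V → ℕ} (hf : IsLabelling r S f) :
    S.image f = Icc 1 S.card := by
  apply eq_of_subset_of_card_le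
  · intro y hy
    obtain ⟨x, hx, rfl⟩ := mem_image.1 hy
    exact hf.2.2.1 x hx
  · rw [card_image_of_injOn hf.2.1]
    simp

variable [DecidableEq V]

theorem IsLabelling.update {S : Finset V} {m : V} (hm : m ∈ S) (hmax : ∀ u ∈ S, ¬ r u m)
    {g : V → ℕ} (hg : IsLabelling r (S.erase m) g) :
    IsLabelling r S (Function.update g m S.card) := by
  obtain ⟨h0, hinj, hmem, hdec⟩ := hg
  have hpos : 0 < S.card := card_pos.2 ⟨m, hm⟩
  rw [card_erase_of_mem hm] at hmem
  have hlt : ∀ x ∈ S, x ≠ m → 1 ≤ g x ∧ g x < S.card := fun x hx hxm => by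
    have := mem_Icc.1 (hmem x (mem_erase.2 ⟨hxm, hx⟩))
    omega
  refine ⟨fun x hx => ?_, fun x hx y hy hxy => ?_, fun x hx => ?_, fun u hu v hv huv => ?_⟩
  · have hxm : x ≠ m := by rintro rfl; exact hx hm
    rw [Function.update_of_ne hxm]
    exact h0 x fun h => hx (mem_of_mem_erase h)
  · by_cases hxm : x = m <;> by_cases hym : y = m
    · rw [hxm, hym]
    · subst hxm
      rw [Function.update_self, Function.update_of_ne hym] at hxy
      have := hlt y hy hym
      omega
    · subst hym
      rw [Function.update_self, Function.update_of_ne hxm] at hxy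
      have := hlt x hx hxm
      omega
    · rw [Function.update_of_ne hxm, Function.update_of_ne hym] at hxy
      exact hinj (by simpa using ⟨hx, hxm⟩) (by simpa using ⟨hy, hym⟩) hxy
  · by_cases hxm : x = m
    · subst hxm
      rw [Function.update_self, mem_Icc]
      omega
    · rw [Function.update_of_ne hxm, mem_Icc]
      have := hlt x hx hxm
      omega
  · have hvm : v ≠ m := by rintro rfl; exact hmax u hu huv
    rw [Function.update_of_ne hvm]
    by_cases hum : u = m
    · subst hum
      rw [Function.update_self]
      exact (hlt v hv hvm).2
    · rw [Function.update_of_ne hum]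
      exact hdec u (mem_erase.2 ⟨hum, hu⟩) v (mem_erase.2 ⟨hvm, hv⟩) huv

theorem IsLabelling.erase {S : Finset V} {m : V} (hm : m ∈ S)
    {f : V → ℕ} (hf : IsLabelling r S f) (hfm : f m = S.card) :
    IsLabelling r (S.erase m) (Function.update f m 0) := by
  obtain ⟨h0, hinj, hmem, hdec⟩ := hf
  refine ⟨fun x hx => ?_, fun x hx y hy hxy => ?_, fun x hx => ?_, fun u hu v hv huv => ?_⟩
  · by_cases hxm : x = m
    · rw [hxm, Function.update_self]
    · rw [Function.update_of_ne hxm]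
      exact h0 x fun h => hx (mem_erase.2 ⟨hxm, h⟩)
  · obtain ⟨hxm, hx⟩ := mem_erase.1 (mem_coe.1 hx)
    obtain ⟨hym, hy⟩ := mem_erase.1 (mem_coe.1 hy)
    rw [Function.update_of_ne hxm, Function.update_of_ne hym] at hxy
    exact hinj hx hy hxy
  · obtain ⟨hxm, hx⟩ := mem_erase.1 hx
    rw [Function.update_of_ne hxm, card_erase_of_mem hm, mem_Icc]
    have h1 := mem_Icc.1 (hmem x hx)
    have h2 : f x ≠ f m := fun h => hxm (hinj hx hm h)
    omega
  · obtain ⟨hum, hu⟩ := mem_erase.1 hu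
    obtain ⟨hvm, hv⟩ := mem_erase.1 hv
    rw [Function.update_of_ne hum, Function.update_of_ne hvm]
    exact hdec u hu v hv huv

/-- The largest label sits at a maximal element; removing it gives a labelling of the rest. -/
theorem linExt_eq_sum [DecidableRel r] {S : Finset V} (hS : S.Nonempty) :
    linExt r S = ∑ m ∈ S with ∀ u ∈ S, ¬ r u m, linExt r (S.erase m) := by
  classical
  rw [← sum_coe_sort]
  unfold linExt
  rw [← Nat.card_sigma]
  symm
  refine Nat.card_congr (Equiv.ofBijective
    (fun x => ⟨Function.update x.2.1 x.1.1 S.card,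
      x.2.2.update (mem_filter.1 x.1.2).1 (mem_filter.1 x.1.2).2⟩) ⟨?_, ?_⟩)
  · rintro ⟨⟨m, hm⟩, g, hg⟩ ⟨⟨m', hm'⟩, g', hg'⟩ h
    have hmS := (mem_filter.1 hm).1
    have hmS' := (mem_filter.1 hm').1
    have h : Function.update g m S.card = Function.update g' m' S.card := congrArg Subtype.val h
    -- All labels on the rest are below `S.card`, so the position of the label `S.card` recovers the
    -- removed element.
    have hmm : m = m' := by
      by_contra hne
      have h1 := congrFun h m
      rw [Function.update_self, Function.update_of_ne hne] at h1
      have h2 := mem_Icc.1 (hg'.2.2.1 m (mem_erase.2 ⟨hne, hmS⟩))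
      rw [card_erase_of_mem hmS'] at h2
      omega
    subst hmm
    have hgg : g = g' := by
      funext x
      by_cases hx : x = m
      · rw [hx, hg.1 m (by simp), hg'.1 m (by simp)]
      · have h1 := congrFun h x
        rwa [Function.update_of_ne hx, Function.update_of_ne hx] at h1
    subst hgg
    rfl
  · rintro ⟨f, hf⟩
    have h1 : S.card ∈ S.image f := by
      rw [hf.image, mem_Icc]
      exact ⟨card_pos.2 hS, le_rfl⟩
    obtain ⟨m, hm, hfm⟩ := mem_image.1 h1
    refine ⟨⟨⟨m, mem_filter.2 ⟨hm, fun u hu hr => ?_⟩⟩, _, hf.erase hm hfm⟩, ?_⟩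
    · have h2 := hf.2.2.2 u hu m hm hr
      have h3 := mem_Icc.1 (hf.2.2.1 u hu)
      omega
    · apply Subtype.ext
      simp [← hfm]

/-- Labellings of incomparable pieces shuffle freely. The induction follows the largest label: it
lies in `P` or in `Q`, and the two cases are the two terms of Pascal's rule. -/
theorem linExt_union {P Q : Finset V} (hd : Disjoint P Q)
    (h : ∀ u ∈ P, ∀ v ∈ Q, ¬ r u v ∧ ¬ r v u) :
    linExt r (P ∪ Q) = (P.card + Q.card).choose P.card * (linExt r P * linExt r Q) := by
  classical
  induction hn : P.card + Q.card generalizing P Q with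
  | zero =>
    have hP : P = ∅ := card_eq_zero.1 (by omega)
    have hQ : Q = ∅ := card_eq_zero.1 (by omega)
    simp [hP, hQ, linExt_empty]
  | succ n ih =>
    rcases P.eq_empty_or_nonempty with rfl | hP
    · simp [linExt_empty]
    rcases Q.eq_empty_or_nonempty with rfl | hQ
    · simp only [card_empty, add_zero] at hn
      simp [linExt_empty, hn]
    rw [linExt_eq_sum (hP.mono subset_union_left), filter_union,
      sum_union (disjoint_filter_filter hd)]
    have e1 : ∑ m ∈ P with ∀ u ∈ P ∪ Q, ¬ r u m, linExt r ((P ∪ Q).erase m) =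
        n.choose (P.card - 1) * (linExt r P * linExt r Q) := by
      rw [linExt_eq_sum hP, sum_mul, mul_sum]
      refine sum_congr (filter_congr fun m hm => ?_) fun m hm => ?_
      · simp only [mem_union]
        exact ⟨fun H u hu => H u (Or.inl hu), fun H u hu => hu.elim (H u) fun hu => (h m hm u hu).2⟩
      · have hm := (mem_filter.1 hm).1
        have hmQ : m ∉ Q := disjoint_left.1 hd hm
        rw [erase_union_distrib, erase_eq_of_notMem hmQ,
          ih (hd.mono_left (erase_subset _ _)) (fun u hu => h u (mem_of_mem_erase hu)),
          card_erase_of_mem hm]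
        rw [card_erase_of_mem hm]
        have := card_pos.2 hP
        omega
    have e2 : ∑ m ∈ Q with ∀ u ∈ P ∪ Q, ¬ r u m, linExt r ((P ∪ Q).erase m) =
        n.choose P.card * (linExt r P * linExt r Q) := by
      rw [linExt_eq_sum hQ, mul_sum, mul_sum]
      refine sum_congr (filter_congr fun m hm => ?_) fun m hm => ?_
      · simp only [mem_union]
        exact ⟨fun H u hu => H u (Or.inr hu), fun H u hu => hu.elim (fun hu => (h u hu m hm).1) (H u)⟩
      · have hm := (mem_filter.1 hm).1
        have hmP : m ∉ P := disjoint_right.1 hd hm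
        rw [erase_union_distrib, erase_eq_of_notMem hmP,
          ih (hd.mono_right (erase_subset _ _)) (fun u hu v hv => h u hu v (mem_of_mem_erase hv))]
        rw [card_erase_of_mem hm]
        have := card_pos.2 hQ
        omega
    rw [e1, e2, ← add_mul]
    congr 1
    obtain ⟨k, hk⟩ : ∃ k, P.card = k + 1 := ⟨P.card - 1, by have := card_pos.2 hP; omega⟩
    rw [hk, Nat.add_sub_cancel, Nat.choose_succ_succ]

/-- The only maximal element is `a`, so it must carry the largest label. -/
theorem linExt_insert {S : Finset V} {a : V} (ha : a ∉ S) (haa : ¬ r a a)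
    (h : ∀ v ∈ S, r a v ∧ ¬ r v a) : linExt r (insert a S) = linExt r S := by
  classical
  rw [linExt_eq_sum (insert_nonempty _ _)]
  have : (insert a S).filter (fun m => ∀ u ∈ insert a S, ¬ r u m) = {a} := by
    ext m
    simp only [mem_filter, mem_insert, mem_singleton]
    constructor
    · rintro ⟨rfl | hm, hu⟩
      · rfl
      · exact absurd (h m hm).1 (hu a (Or.inl rfl))
    · rintro rfl
      exact ⟨Or.inl rfl, fun u hu => hu.elim (fun e => e ▸ haa) fun hu => (h u hu).2⟩
  rw [this, sum_singleton, erase_insert ha]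

theorem linExt_image {S : Finset V} {φ : V → V} (hφ : Function.Injective φ)
    (h : ∀ u v, r (φ u) (φ v) ↔ r u v) : linExt r (S.image φ) = linExt r S := by
  classical
  induction hn : S.card generalizing S with
  | zero =>
    rw [card_eq_zero.1 hn, image_empty]
  | succ n ih =>
    have hS : S.Nonempty := card_pos.1 (by omega)
    rw [linExt_eq_sum hS, linExt_eq_sum (hS.image φ), filter_image, sum_image hφ.injOn]
    refine sum_congr (filter_congr fun m hm => ?_) fun m hm => ?_
    · simp [h]
    · have hm := (mem_filter.1 hm).1
      rw [← image_erase hφ, ih]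
      rw [card_erase_of_mem hm]
      omega

end LinearExtensions

/-! ### Decomposition of a binary tree and of its labellings at the root. -/

theorem card_sideLabelling (s : Side) (B : BinaryTree Unit) :
    Nat.card (SideLabelling s B) = linExt IsAncestor (children s B) := by
  classical
  refine Nat.card_congr (Equiv.ofBijective (fun L =>
    ⟨fun x => if h : x ∈ children s B then (L.label ⟨x, h⟩).1 else 0, ?_, ?_, ?_, ?_⟩) ⟨?_, ?_⟩)
  · intro x hx
    exact dif_neg hx
  · intro x hx y hy hxy
    have hx : x ∈ children s B := hx
    have hy : y ∈ children s B := hy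
    simp only [dif_pos hx, dif_pos hy] at hxy
    exact congrArg Subtype.val (L.injective (Subtype.ext hxy))
  · intro x hx
    simp only [dif_pos hx]
    exact (L.label ⟨x, hx⟩).2
  · intro u hu v hv huv
    simp only [dif_pos hu, dif_pos hv]
    exact L.decreasing ⟨u, hu⟩ ⟨v, hv⟩ huv
  · intro L L' h
    ext x
    have := congrFun (congrArg Subtype.val h) x.1
    simpa [dif_pos x.2] using this
  · rintro ⟨f, h0, hinj, hmem, hdec⟩
    refine ⟨⟨fun x => ⟨f x.1, hmem x.1 x.2⟩, fun x y hxy => Subtype.ext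
      (hinj x.2 y.2 (congrArg Subtype.val hxy)), fun u v huv => hdec u.1 u.2 v.1 v.2 huv⟩, ?_⟩
    apply Subtype.ext
    funext x
    by_cases hx : x ∈ children s B
    · simp [hx]
    · simp [hx, h0 x hx]

theorem mem_vertices_node {a : Unit} {l r : BinaryTree Unit} {v : Vertex} :
    v ∈ vertices (.node a l r) ↔ v = [] ∨ (∃ u ∈ vertices l, Side.left :: u = v) ∨
      ∃ u ∈ vertices r, Side.right :: u = v := by
  simp [vertices]

theorem vertices_nil : vertices .nil = ∅ := rfl

theorem nil_mem_vertices {B : BinaryTree Unit} (hB : B ≠ .nil) : [] ∈ vertices B := by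
  cases B with
  | nil => exact absurd rfl hB
  | node => simp [vertices]

/-- The vertices on side `s` of a tree whose child on side `s'` is the root of `B`, as far as
they belong to `B`. -/
def hang (s s' : Side) (B : BinaryTree Unit) : Finset Vertex :=
  ((vertices B).image (s' :: ·)).filter fun v => v.getLast? = some s

theorem children_nil (s : Side) : children s .nil = ∅ := rfl

theorem children_node (s : Side) (a : Unit) (l r : BinaryTree Unit) :
    children s (.node a l r) = hang s .left l ∪ hang s .right r := by
  rw [children, vertices, filter_insert, if_neg (by simp), filter_union]
  rfl

theorem getLast?_cons_eq {s s' : Side} {v : Vertex} (hv : v ≠ []) :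
    (s' :: v).getLast? = some s ↔ v.getLast? = some s := by
  obtain ⟨t, u, rfl⟩ := List.exists_cons_of_ne_nil hv
  rw [List.getLast?_cons_cons]

theorem hang_of_ne {s s' : Side} (h : s ≠ s') (B : BinaryTree Unit) :
    hang s s' B = (children s B).image (s' :: ·) := by
  rw [hang, filter_image, children]
  congr 1
  refine filter_congr fun v _ => ?_
  rcases eq_or_ne v [] with rfl | hv
  · simpa using h.symm
  · exact getLast?_cons_eq hv

theorem hang_self (s : Side) {B : BinaryTree Unit} (hB : B ≠ .nil) :
    hang s s B = (insert [] (children s B)).image (s :: ·) := by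
  rw [hang, filter_image, children]
  congr 1
  ext v
  rcases eq_or_ne v [] with rfl | hv
  · simp [nil_mem_vertices hB]
  · simp [getLast?_cons_eq hv, hv]

theorem hang_nil (s s' : Side) : hang s s' .nil = ∅ := rfl

theorem nil_notMem_children (s : Side) (B : BinaryTree Unit) : [] ∉ children s B := by
  simp [children]

theorem isAncestor_cons (s : Side) (u v : Vertex) :
    IsAncestor (s :: u) (s :: v) ↔ IsAncestor u v := by
  simp [IsAncestor, List.cons_prefix_cons]

/-- If `s = s'`, the root of `B` is a new vertex on side `s` above all the others, so its label is
forced; otherwise no vertex on side `s` is gained. Thus hanging changes only the size of the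
labelled set. -/
theorem linExt_hang (s s' : Side) (B : BinaryTree Unit) :
    linExt IsAncestor (hang s s' B) = linExt IsAncestor (children s B) := by
  by_cases h : s = s'
  · subst h
    by_cases hB : B = .nil
    · subst hB
      rw [hang_nil, children_nil]
    · rw [hang_self s hB, linExt_image List.cons_injective (isAncestor_cons s),
        linExt_insert (nil_notMem_children s B)]
      · exact fun h => h.2 rfl
      · intro v hv
        have hv : v ≠ [] := by rintro rfl; exact nil_notMem_children s B hv
        exact ⟨⟨List.nil_prefix, hv.symm⟩, fun h => hv (List.prefix_nil.1 h.1)⟩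
  · rw [hang_of_ne h, linExt_image List.cons_injective (isAncestor_cons s')]

theorem card_hang_self (s : Side) {B : BinaryTree Unit} (hB : B ≠ .nil) :
    (hang s s B).card = (children s B).card + 1 := by
  rw [hang_self s hB, card_image_of_injective _ List.cons_injective,
    card_insert_of_notMem (nil_notMem_children s B)]

theorem card_hang_of_ne {s s' : Side} (h : s ≠ s') (B : BinaryTree Unit) :
    (hang s s' B).card = (children s B).card := by
  rw [hang_of_ne h, card_image_of_injective _ List.cons_injective]

theorem hang_cons {s s' : Side} {B : BinaryTree Unit} {v : Vertex} (h : v ∈ hang s s' B) :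
    ∃ u, v = s' :: u := by
  obtain ⟨u, -, rfl⟩ := mem_image.1 (mem_filter.1 h).1
  exact ⟨u, rfl⟩

theorem disjoint_hang (s : Side) (l r : BinaryTree Unit) :
    Disjoint (hang s .left l) (hang s .right r) := by
  rw [disjoint_left]
  intro v hl hr
  obtain ⟨u, rfl⟩ := hang_cons hl
  obtain ⟨u', h⟩ := hang_cons hr
  simp at h

theorem card_children_node (s : Side) (a : Unit) (l r : BinaryTree Unit) :
    (children s (.node a l r)).card = (hang s .left l).card + (hang s .right r).card := by
  rw [children_node, card_union_of_disjoint (disjoint_hang s l r)]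

theorem linExt_children_node (s : Side) (a : Unit) (l r : BinaryTree Unit) :
    linExt IsAncestor (children s (.node a l r)) =
      ((hang s .left l).card + (hang s .right r).card).choose (hang s .left l).card *
        (linExt IsAncestor (children s l) * linExt IsAncestor (children s r)) := by
  rw [children_node, linExt_union (disjoint_hang s l r), linExt_hang, linExt_hang]
  intro u hu v hv
  obtain ⟨u, rfl⟩ := hang_cons hu
  obtain ⟨v, rfl⟩ := hang_cons hv
  simp [IsAncestor, List.cons_prefix_cons]

theorem card_children_add {B : BinaryTree Unit} (hB : B ≠ .nil) :
    (children .left B).card + (children .right B).card + 1 = B.numNodes := by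
  induction B with
  | nil => exact absurd rfl hB
  | node a l r ihl ihr =>
    have hl : (hang .left .left l).card + (hang .right .left l).card = l.numNodes := by
      by_cases h : l = .nil
      · subst h; rfl
      · rw [card_hang_self _ h, card_hang_of_ne (by decide), ← ihl h]
        omega
    have hr : (hang .left .right r).card + (hang .right .right r).card = r.numNodes := by
      by_cases h : r = .nil
      · subst h; rfl
      · rw [card_hang_self _ h, card_hang_of_ne (by decide), ← ihr h]
        omega
    rw [card_children_node, card_children_node, BinaryTree.numNodes]
    omega

/-- The subtree at the child of the root on side `s`. -/
def child : Side → BinaryTree Unit → BinaryTree Unit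
  | _, .nil => .nil
  | .left, .node _ l _ => l
  | .right, .node _ _ r => r

theorem cons_mem_vertices {s : Side} {B : BinaryTree Unit} {v : Vertex} :
    s :: v ∈ vertices B ↔ v ∈ vertices (child s B) := by
  cases B with
  | nil => cases s <;> simp [child, vertices_nil]
  | node a l r => cases s <;> simp [child, mem_vertices_node]

theorem mem_branch_root {s : Side} {B : BinaryTree Unit} {x : Vertex} :
    x ∈ branch s B [] ↔ x ∈ vertices B ∧ ∃ k : ℕ, x = List.replicate k s := by
  simp [branch]

theorem branch_inter_children (s : Side) (B : BinaryTree Unit) :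
    branch s B [] ∩ children s B = (branch s (child s B) []).image (s :: ·) := by
  ext x
  simp only [mem_inter, mem_image, mem_branch_root, children, mem_filter]
  constructor
  · rintro ⟨⟨hx, k, rfl⟩, -, hlast⟩
    cases k with
    | zero => simp at hlast
    | succ k =>
      rw [List.replicate_succ, cons_mem_vertices] at hx
      exact ⟨_, ⟨hx, k, rfl⟩, rfl⟩
  · rintro ⟨x, ⟨hx, k, rfl⟩, rfl⟩
    rw [← cons_mem_vertices] at hx
    refine ⟨⟨hx, k + 1, rfl⟩, hx, ?_⟩
    change (List.replicate (k + 1) s).getLast? = _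
    simp [List.getLast?_replicate]

theorem branch_root_eq_insert (s : Side) {B : BinaryTree Unit} (hB : B ≠ .nil) :
    branch s B [] = insert [] (branch s B [] ∩ children s B) := by
  ext x
  rw [mem_insert, branch_inter_children, mem_image, mem_branch_root]
  simp only [mem_branch_root]
  constructor
  · rintro ⟨hx, k, rfl⟩
    cases k with
    | zero => exact Or.inl rfl
    | succ k => exact Or.inr ⟨_, ⟨cons_mem_vertices.1 hx, k, rfl⟩, rfl⟩
  · rintro (rfl | ⟨x, ⟨hx, k, rfl⟩, rfl⟩)
    · exact ⟨nil_mem_vertices hB, 0, rfl⟩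
    · exact ⟨cons_mem_vertices.2 hx, k + 1, rfl⟩

theorem rootBranchCount_eq (s : Side) {B : BinaryTree Unit} (hB : child s B ≠ .nil) :
    rootBranchCount s B = rootBranchCount s (child s B) + 1 := by
  rw [rootBranchCount, branch_inter_children, card_image_of_injective _ List.cons_injective,
    branch_root_eq_insert s hB, card_insert_of_notMem, rootBranchCount]
  exact fun h => nil_notMem_children _ _ (mem_inter.1 h).2

theorem rootBranchCount_eq_zero (s : Side) {B : BinaryTree Unit} (hB : child s B = .nil) :
    rootBranchCount s B = 0 := by
  rw [rootBranchCount, branch_inter_children, hB]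
  rfl

/-! ### Hook starts and the hook number. -/

/-- The position of a vertex in its hook: `none` for the vertex from which the hook starts,
`some s` for the other vertices of its branch on side `s`. This is the position of a child on
side `s`, given the position of its parent. -/
def hookStep : Option Side → Side → Option Side
  | none, s => some s
  | some t, s => if s = t then some t else none

/-- The number of hook starts in a tree whose root has position `q`. -/
def hookStarts : Option Side → BinaryTree Unit → ℕ
  | _, .nil => 0
  | q, .node _ l r => (if q = none then 1 else 0) +
      (hookStarts (hookStep q .left) l + hookStarts (hookStep q .right) r)

/-- The position of a vertex is found by running `hookStep` along its path, which turns the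
recursive count into a condition on single vertices. -/
theorem hookStarts_eq_card (q : Option Side) (B : BinaryTree Unit) :
    hookStarts q B = ((vertices B).filter fun v => v.foldl hookStep q = none).card := by
  induction B generalizing q with
  | nil => rfl
  | node a l r ihl ihr =>
    rw [hookStarts, ihl, ihr, vertices, filter_insert, filter_union, filter_image, filter_image]
    have hd : Disjoint
        (((vertices l).filter fun v => (Side.left :: v).foldl hookStep q = none).image
          (Side.left :: ·))
        (((vertices r).filter fun v => (Side.right :: v).foldl hookStep q = none).image
          (Side.right :: ·)) := by
      rw [disjoint_left]
      intro x hx hx'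
      obtain ⟨y, -, rfl⟩ := mem_image.1 hx
      obtain ⟨z, -, hz⟩ := mem_image.1 hx'
      simp at hz
    have hc : (((vertices l).filter fun v => (Side.left :: v).foldl hookStep q = none).image
          (Side.left :: ·) ∪
        ((vertices r).filter fun v => (Side.right :: v).foldl hookStep q = none).image
          (Side.right :: ·)).card =
        ((vertices l).filter fun v => v.foldl hookStep (hookStep q .left) = none).card +
        ((vertices r).filter fun v => v.foldl hookStep (hookStep q .right) = none).card := by
      rw [card_union_of_disjoint hd, card_image_of_injective _ List.cons_injective,
        card_image_of_injective _ List.cons_injective]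
      rfl
    by_cases h : q = none
    · rw [if_pos h, if_pos (show List.foldl hookStep q [] = none from h),
        card_insert_of_notMem (by simp), hc, add_comm]
    · rw [if_neg h, if_neg (show ¬ List.foldl hookStep q [] = none from h), hc, zero_add]

theorem foldl_hookStep_replicate {v : Vertex} (hv : v.foldl hookStep none = none) (s : Side)
    (k : ℕ) : (v ++ List.replicate (k + 1) s).foldl hookStep none = some s := by
  rw [List.foldl_append, hv]
  induction k with
  | zero => rfl
  | succ k ih =>
    rw [List.replicate_succ', List.foldl_append, ih]
    simp [hookStep]

/-- The last step of the path either prolongs the straight run from the last hook start or turns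
away from it; a turn makes `x` itself a hook start. -/
theorem exists_hookStart (x : Vertex) :
    ∃ v k s, v.foldl hookStep none = none ∧ x = v ++ List.replicate k s := by
  induction x using List.reverseRecOn with
  | nil => exact ⟨[], 0, .left, rfl, rfl⟩
  | append_singleton x s ih =>
    obtain ⟨v, k, t, hv, rfl⟩ := ih
    cases k with
    | zero => exact ⟨v, 1, s, hv, by simp⟩
    | succ k =>
      by_cases h : s = t
      · subst h
        exact ⟨v, k + 2, s, hv, by rw [List.append_assoc, ← List.replicate_succ']⟩
      · refine ⟨_, 0, s, ?_, (List.append_nil _).symm⟩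
        rw [List.foldl_append, foldl_hookStep_replicate hv]
        simp [hookStep, h]

theorem vertices_of_append {B : BinaryTree Unit} {u v : Vertex} (h : u ++ v ∈ vertices B) :
    u ∈ vertices B := by
  induction u generalizing B with
  | nil =>
    refine nil_mem_vertices ?_
    rintro rfl
    simp [vertices_nil] at h
  | cons s u ih =>
    rw [List.cons_append, cons_mem_vertices] at h
    exact cons_mem_vertices.2 (ih h)

/-- The lower of the two vertices lies in the hook of the upper one. Being itself a hook start, it
cannot be a positive number of straight steps below. -/
theorem eq_of_mem_hook {B : BinaryTree Unit} {u v x : Vertex} (hu : u ∈ vertices B)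
    (hv : v ∈ vertices B) (hu' : u.foldl hookStep none = none)
    (hv' : v.foldl hookStep none = none) (hxu : x ∈ hook B u) (hxv : x ∈ hook B v) : u = v := by
  wlog hl : u.length ≤ v.length generalizing u v
  · exact (this hv hu hv' hu' hxv hxu (le_of_not_ge hl)).symm
  obtain ⟨-, k, s, rfl⟩ := (mem_hook hu).1 (hook_meet hu hv hxu hxv hl)
  cases k with
  | zero => simp
  | succ k =>
    rw [foldl_hookStep_replicate hu'] at hv'
    cases hv'

/-- The hooks of the hook starts form a hook partition, which is the chosen one by uniqueness. -/
theorem hookNumber_eq (B : BinaryTree Unit) : hookNumber B = hookStarts none B := by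
  set F := (vertices B).filter fun v => v.foldl hookStep none = none with hF
  let P : Finpartition (vertices B) := Finpartition.ofExistsUnique (F.image (hook B))
    (by
      intro p hp
      obtain ⟨u, hu, rfl⟩ := mem_image.1 hp
      exact fun x hx => ((mem_hook (mem_filter.1 hu).1).1 hx).1)
    (by
      intro x hx
      obtain ⟨v, k, s, hv, hxv⟩ := exists_hookStart x
      have hvB : v ∈ vertices B := vertices_of_append (hxv ▸ hx)
      have hxh : x ∈ hook B v := (mem_hook hvB).2 ⟨hx, k, s, hxv⟩
      refine ⟨hook B v, ⟨mem_image_of_mem _ (mem_filter.2 ⟨hvB, hv⟩), hxh⟩, ?_⟩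
      rintro _ ⟨hp, hxp⟩
      obtain ⟨u, hu, rfl⟩ := mem_image.1 hp
      obtain ⟨huB, hu⟩ := mem_filter.1 hu
      rw [eq_of_mem_hook huB hvB hu hv hxp hxh])
    (by
      intro hp
      obtain ⟨v, -, hv⟩ := mem_image.1 hp
      have := self_mem_hook (B := B) v
      rw [hv] at this
      simp at this)
  have hP : IsHookPartition B P := by
    intro A hA
    obtain ⟨u, hu, rfl⟩ := mem_image.1 hA
    exact ⟨u, (mem_filter.1 hu).1, rfl⟩
  have huniq := existsUnique_isHookPartition B
  rw [hookNumber, huniq.unique huniq.choose_spec.1 hP, hookStarts_eq_card]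
  change (F.image (hook B)).card = F.card
  refine card_image_of_injOn fun u hu v hv h => ?_
  exact hook_injective (mem_filter.1 hu).1 (mem_filter.1 hv).1 h

/-! ### Adding one element to a set partition. -/

section SetPartitions

variable {V : Type*} [DecidableEq V]

theorem eq_of_mem_insert_empty {S : Finset V} (P : Finpartition S) {A B : Finset V}
    (hA : A ∈ insert ∅ P.parts) (hB : B ∈ P.parts) {x : V} (hxA : x ∈ A) (hxB : x ∈ B) : A = B := by
  rcases mem_insert.1 hA with rfl | hA
  · simp at hxA
  · exact P.eq_of_mem_parts hA hB hxA hxB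

/-- Adjoin `a` to the part `A` of a partition, or as a new part if `A = ∅`. -/
def adjoin {S : Finset V} (a : V) (ha : a ∉ S) (P : Finpartition S) (A : Finset V)
    (hA : A ∈ insert ∅ P.parts) : Finpartition (insert a S) :=
  Finpartition.ofExistsUnique (insert (insert a A) (P.parts.erase A))
    (by
      intro p hp
      rcases mem_insert.1 hp with rfl | hp
      · refine insert_subset_insert _ ?_
        rcases mem_insert.1 hA with rfl | hA
        · exact empty_subset _
        · exact P.subset hA
      · exact (P.subset (mem_of_mem_erase hp)).trans (subset_insert _ _))
    (by
      intro x hx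
      by_cases hxA : x ∈ insert a A
      · refine ⟨insert a A, ⟨mem_insert_self _ _, hxA⟩, ?_⟩
        rintro t ⟨ht, hxt⟩
        rcases mem_insert.1 ht with rfl | ht
        · rfl
        · obtain ⟨htA, htP⟩ := mem_erase.1 ht
          rcases mem_insert.1 hxA with hxa | hxA
          · exact absurd (hxa ▸ P.subset htP hxt) ha
          · exact absurd (eq_of_mem_insert_empty P hA htP hxA hxt).symm htA
      · rw [mem_insert, not_or] at hxA
        have hxS : x ∈ S := (mem_insert.1 hx).resolve_left hxA.1
        obtain ⟨t, ht, hxt⟩ := P.exists_mem hxS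
        refine ⟨t, ⟨mem_insert_of_mem (mem_erase.2 ⟨?_, ht⟩), hxt⟩, ?_⟩
        · rintro rfl
          exact hxA.2 hxt
        · rintro u ⟨hu, hxu⟩
          rcases mem_insert.1 hu with rfl | hu
          · exact absurd (mem_insert.1 hxu) (not_or.2 hxA)
          · exact P.eq_of_mem_parts (mem_of_mem_erase hu) ht hxu hxt)
    (by
      intro h
      rcases mem_insert.1 h with h | h
      · exact insert_ne_empty a A h.symm
      · exact P.empty_notMem_parts (mem_of_mem_erase h))

theorem adjoin_parts {S : Finset V} (a : V) (ha : a ∉ S) (P : Finpartition S) (A : Finset V)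
    (hA : A ∈ insert ∅ P.parts) :
    (adjoin a ha P A hA).parts = insert (insert a A) (P.parts.erase A) := rfl

/-- Remove `a` from a partition. -/
def unadjoin {S : Finset V} (a : V) (ha : a ∉ S) (Q : Finpartition (insert a S)) :
    Finpartition S :=
  -- If `a` forms a part of its own, removing it leaves an empty set, which has to be discarded.
  Finpartition.ofExistsUnique ((insert ((Q.part a).erase a) (Q.parts.erase (Q.part a))).erase ∅)
    (by
      intro p hp
      rcases mem_insert.1 (mem_of_mem_erase hp) with rfl | hp
      · exact fun x hx => (mem_insert.1 (Q.part_subset a (mem_of_mem_erase hx))).resolve_left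
          (ne_of_mem_erase hx)
      · obtain ⟨hpa, hp⟩ := mem_erase.1 hp
        intro x hx
        refine (mem_insert.1 (Q.subset hp hx)).resolve_left ?_
        rintro rfl
        exact hpa (Q.part_eq_of_mem hp hx).symm)
    (by
      intro x hx
      have hxa : x ≠ a := by rintro rfl; exact ha hx
      have hxS : x ∈ insert a S := mem_insert_of_mem hx
      by_cases hxA : x ∈ Q.part a
      · have hx' : x ∈ (Q.part a).erase a := mem_erase.2 ⟨hxa, hxA⟩
        refine ⟨(Q.part a).erase a, ⟨mem_erase.2 ⟨ne_empty_of_mem hx', mem_insert_self _ _⟩, hx'⟩, ?_⟩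
        rintro t ⟨ht, hxt⟩
        rcases mem_insert.1 (mem_of_mem_erase ht) with rfl | ht
        · rfl
        · obtain ⟨hta, ht⟩ := mem_erase.1 ht
          exact absurd (Q.eq_of_mem_parts ht (Q.part_mem.2 (mem_insert_self _ _)) hxt hxA) hta
      · obtain ⟨t, ht, hxt⟩ := Q.exists_mem hxS
        refine ⟨t, ⟨mem_erase.2 ⟨ne_empty_of_mem hxt,
          mem_insert_of_mem (mem_erase.2 ⟨?_, ht⟩)⟩, hxt⟩, ?_⟩
        · rintro rfl
          exact hxA hxt
        · rintro u ⟨hu, hxu⟩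
          rcases mem_insert.1 (mem_of_mem_erase hu) with rfl | hu
          · exact absurd (mem_of_mem_erase hxu) hxA
          · exact Q.eq_of_mem_parts (mem_of_mem_erase hu) ht hxu hxt)
    (by simp)

theorem unadjoin_parts {S : Finset V} (a : V) (ha : a ∉ S) (Q : Finpartition (insert a S)) :
    (unadjoin a ha Q).parts =
      (insert ((Q.part a).erase a) (Q.parts.erase (Q.part a))).erase ∅ := rfl

theorem adjoin_part_self {S : Finset V} (a : V) (ha : a ∉ S) (P : Finpartition S) (A : Finset V)
    (hA : A ∈ insert ∅ P.parts) : (adjoin a ha P A hA).part a = insert a A :=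
  Finpartition.part_eq_of_mem _ (by rw [adjoin_parts]; exact mem_insert_self _ _)
    (mem_insert_self _ _)

theorem notMem_of_mem_insert_empty {S : Finset V} {a : V} (ha : a ∉ S) (P : Finpartition S)
    {A : Finset V} (hA : A ∈ insert ∅ P.parts) : a ∉ A := by
  rcases mem_insert.1 hA with rfl | hA
  · simp
  · exact fun h => ha (P.subset hA h)

/-- A partition of the larger set amounts to a partition of `S` and the part that `a` joins, where
`∅` encodes that `a` is alone. -/
theorem sum_finpartition_insert {M : Type*} [AddCommMonoid M] {S : Finset V} (a : V) (ha : a ∉ S)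
    (f : Finpartition (insert a S) → M) :
    ∑ Q, f Q = ∑ P : Finpartition S, ∑ A ∈ (insert ∅ P.parts).attach, f (adjoin a ha P A.1 A.2) := by
  rw [sum_sigma']
  symm
  refine sum_bij' (fun x _ => adjoin a ha x.1 x.2.1 x.2.2)
    (fun Q _ => ⟨unadjoin a ha Q, (Q.part a).erase a, ?_⟩) ?_ ?_ ?_ ?_ ?_
  · rw [unadjoin_parts, mem_insert, mem_erase, or_iff_not_imp_left]
    exact fun h => ⟨h, mem_insert_self _ _⟩
  · simp
  · exact fun _ _ => mem_sigma.2 ⟨mem_univ _, mem_attach _ _⟩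
  · rintro ⟨P, A, hA⟩ -
    have haA := notMem_of_mem_insert_empty ha P hA
    have h1 : unadjoin a ha (adjoin a ha P A hA) = P := by
      apply Finpartition.ext
      have h2 : insert a A ∉ P.parts.erase A := fun h =>
        ha (P.subset (mem_of_mem_erase h) (mem_insert_self _ _))
      rw [unadjoin_parts, adjoin_part_self, adjoin_parts, erase_insert haA, erase_insert h2]
      rcases mem_insert.1 hA with rfl | hA
      · rw [erase_insert_eq_erase, erase_idem, erase_eq_of_notMem P.empty_notMem_parts]
      · rw [insert_erase hA, erase_eq_of_notMem P.empty_notMem_parts]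
    have h3 : ((adjoin a ha P A hA).part a).erase a = A := by
      rw [adjoin_part_self, erase_insert haA]
    have ext : ∀ (P' : Finpartition S) (A' : Finset V) (hA' : A' ∈ insert ∅ P'.parts), P' = P →
        A' = A → (⟨P', A', hA'⟩ : Σ P : Finpartition S, {A // A ∈ insert ∅ P.parts}) =
          ⟨P, A, hA⟩ := by
      rintro P' A' hA' rfl rfl
      rfl
    exact ext _ _ _ h1 h3
  · intro Q _
    apply Finpartition.ext
    have haQ : a ∈ Q.part a := Q.mem_part_self.2 (mem_insert_self _ _)
    have hQ : Q.part a ∈ Q.parts := Q.part_mem.2 (mem_insert_self _ _)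
    change insert (insert a ((Q.part a).erase a))
      ((unadjoin a ha Q).parts.erase ((Q.part a).erase a)) = Q.parts
    rw [unadjoin_parts, insert_erase haQ]
    have h1 : (Q.part a).erase a ∉ Q.parts.erase (Q.part a) := by
      intro h
      obtain ⟨h2, h3⟩ := mem_erase.1 h
      obtain ⟨x, hx⟩ := Q.nonempty_of_mem_parts h3
      exact h2 (Q.eq_of_mem_parts h3 hQ hx (mem_of_mem_erase hx))
    rw [erase_right_comm, erase_insert h1, erase_eq_of_notMem, insert_erase hQ]
    exact fun h => Q.empty_notMem_parts (mem_of_mem_erase h)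
  · simp

theorem adjoin_card {S : Finset V} (a : V) (ha : a ∉ S) (P : Finpartition S) (A : Finset V)
    (hA : A ∈ insert ∅ P.parts) :
    (adjoin a ha P A hA).parts.card = P.parts.card + if A = ∅ then 1 else 0 := by
  have h2 : insert a A ∉ P.parts.erase A := fun h =>
    ha (P.subset (mem_of_mem_erase h) (mem_insert_self _ _))
  rw [adjoin_parts, card_insert_of_notMem h2]
  split_ifs with h
  · rw [h, erase_eq_of_notMem P.empty_notMem_parts]
  · have hA := (mem_insert.1 hA).resolve_left h
    rw [card_erase_of_mem hA]
    have := card_pos.2 ⟨A, hA⟩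
    omega

theorem adjoin_part_card {S : Finset V} (a : V) (ha : a ∉ S) (P : Finpartition S) (A : Finset V)
    (hA : A ∈ insert ∅ P.parts) {b : V} (hb : b ∈ S) :
    (((adjoin a ha P A hA).part b).erase b).card =
      ((P.part b).erase b).card + if A = P.part b then 1 else 0 := by
  have hbP : b ∈ P.part b := P.mem_part_self.2 hb
  have haA := notMem_of_mem_insert_empty ha P hA
  have hbQ : b ∈ (adjoin a ha P A hA).part b :=
    (Finpartition.mem_part_self _).2 (mem_insert_of_mem hb)
  rw [card_erase_of_mem hbP, card_erase_of_mem hbQ]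
  have hpos := card_pos.2 ⟨b, hbP⟩
  split_ifs with h
  · have : (adjoin a ha P A hA).part b = insert a A :=
      Finpartition.part_eq_of_mem _ (by rw [adjoin_parts]; exact mem_insert_self _ _)
        (mem_insert_of_mem (h ▸ hbP))
    rw [this, card_insert_of_notMem haA, h]
    omega
  · have : (adjoin a ha P A hA).part b = P.part b :=
      Finpartition.part_eq_of_mem _ (by
        rw [adjoin_parts]
        exact mem_insert_of_mem (mem_erase.2 ⟨Ne.symm h, P.part_mem.2 hb⟩)) hbP
    rw [this]
    omega

/-- The sum, over the partitions of `S` in `k` parts, of `q` to the number of other elements in the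
part of `b`. -/
noncomputable def partSum {R : Type*} [CommSemiring R] (q : R) (b : V) (S : Finset V) (k : ℕ) : R :=
  ∑ P : Finpartition S with P.parts.card = k, q ^ ((P.part b).erase b).card

/-- The new element joins the part of `b` (factor `q`), joins one of the `k` other parts (factor 1
each), or opens a part. -/
theorem partSum_insert {R : Type*} [CommSemiring R] (q : R) {a b : V} {S : Finset V} (ha : a ∉ S)
    (hb : b ∈ S) (k : ℕ) :
    partSum q b (insert a S) (k + 1) = (q + k) * partSum q b S (k + 1) + partSum q b S k := by
  simp only [partSum, sum_filter]
  rw [sum_finpartition_insert a ha, mul_sum, ← sum_add_distrib]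
  refine sum_congr rfl fun P _ => ?_
  have hbP : P.part b ∈ P.parts := P.part_mem.2 hb
  have h0 : P.part b ≠ ∅ := P.ne_empty hbP
  simp only [adjoin_card, adjoin_part_card _ _ _ _ _ hb]
  rw [sum_attach (insert ∅ P.parts) fun A =>
    if P.parts.card + (if A = ∅ then 1 else 0) = k + 1 then
      q ^ (((P.part b).erase b).card + if A = P.part b then 1 else 0) else 0,
    sum_insert P.empty_notMem_parts, if_pos rfl, if_neg h0.symm, add_comm]
  congr 1
  · rw [mul_ite, mul_zero]
    have h1 : ∀ A ∈ P.parts, (if P.parts.card + (if A = ∅ then 1 else 0) = k + 1 then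
        q ^ (((P.part b).erase b).card + if A = P.part b then 1 else 0) else 0) =
        if P.parts.card = k + 1 then
          q ^ (((P.part b).erase b).card + if A = P.part b then 1 else 0) else 0 := fun A hA => by
      rw [if_neg (P.ne_empty hA), add_zero]
    rw [sum_congr rfl h1]
    split_ifs with hk
    · rw [← add_sum_erase _ _ hbP, if_pos rfl]
      have h2 : ∀ A ∈ P.parts.erase (P.part b),
          q ^ (((P.part b).erase b).card + if A = P.part b then 1 else 0) =
          q ^ ((P.part b).erase b).card := fun A hA => by
        rw [if_neg (ne_of_mem_erase hA), add_zero]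
      rw [sum_congr rfl h2, sum_const, card_erase_of_mem hbP, hk, Nat.add_sub_cancel, nsmul_eq_mul]
      ring
    · simp
  · simp

theorem partSum_zero {R : Type*} [CommSemiring R] (q : R) {b : V} {S : Finset V} (hb : b ∈ S) :
    partSum q b S 0 = 0 := by
  rw [partSum, filter_false_of_mem, sum_empty]
  intro P _ h
  have := card_pos.2 ⟨_, P.part_mem.2 hb⟩
  omega

theorem partSum_singleton {R : Type*} [CommSemiring R] (q : R) (b : V) (k : ℕ) :
    partSum q b {b} k = if k = 1 then 1 else 0 := by
  have h : ∀ P : Finpartition ({b} : Finset V), P.parts = {{b}} := by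
    intro P
    ext t
    rw [mem_singleton]
    constructor
    · intro ht
      exact (subset_singleton_iff.1 (P.subset ht)).resolve_left (P.ne_empty ht)
    · rintro rfl
      obtain ⟨t, ht, -⟩ := P.exists_mem (mem_singleton_self b)
      have htb := (subset_singleton_iff.1 (P.subset ht)).resolve_left (P.ne_empty ht)
      exact htb ▸ ht
  let u : Unique (Finpartition ({b} : Finset V)) :=
    { default := Finpartition.indiscrete (singleton_ne_empty b)
      uniq := fun P => Finpartition.ext (by rw [h P, h]) }
  rw [partSum, sum_filter, Fintype.sum_unique, h, card_singleton]
  have h1 : (((default : Finpartition ({b} : Finset V)).part b).erase b).card = 0 := by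
    rw [card_eq_zero, erase_eq_empty_iff]
    exact subset_singleton_iff.1 (Finpartition.part_subset _ _)
  rw [h1, pow_zero]
  simp [eq_comm]

end SetPartitions

/-! ### The recursion of the q-Stirling numbers. -/

section QStirling

variable {R : Type*} [CommSemiring R] (q : R)

theorem qStirling_eq (n k : ℕ) : qStirling q n k = partSum q 1 (Icc 1 n) k := rfl

theorem qStirling_one (k : ℕ) : qStirling q 1 k = if k = 1 then 1 else 0 := by
  rw [qStirling_eq, Icc_self, partSum_singleton]

theorem qStirling_succ_zero (n : ℕ) : qStirling q (n + 1) 0 = 0 :=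
  partSum_zero q (by simp)

theorem qStirling_succ_succ (n k : ℕ) :
    qStirling q (n + 2) (k + 1) = (q + k) * qStirling q (n + 1) (k + 1) + qStirling q (n + 1) k := by
  have h : Icc 1 (n + 2) = insert (n + 2) (Icc 1 (n + 1)) := by
    ext x
    simp only [mem_Icc, mem_insert]
    omega
  rw [qStirling_eq, qStirling_eq, qStirling_eq, h, partSum_insert q (by simp) (by simp)]

theorem qStirling_eq_zero {n k : ℕ} (h : n < k) : qStirling q n k = 0 := by
  rw [qStirling, filter_false_of_mem, sum_empty]
  intro P _ hP
  have := P.card_parts_le_card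
  simp at this
  omega

theorem map_qStirling {R' : Type*} [CommSemiring R'] (φ : R →+* R') (n k : ℕ) :
    φ (qStirling q n k) = qStirling (φ q) n k := by
  simp [qStirling, map_sum]

end QStirling

/-! ### Binary trees sorted by their numbers of left and right vertices. -/

section Shapes

theorem card_hang_add (s : Side) (B : BinaryTree Unit) :
    (hang .left s B).card + (hang .right s B).card = B.numNodes := by
  by_cases h : B = .nil
  · subst h; rfl
  · rw [← card_children_add h]
    cases s
    · rw [card_hang_self _ h, card_hang_of_ne (by decide)]
      omega
    · rw [card_hang_self _ h, card_hang_of_ne (by decide)]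
      omega

/-- The non-empty binary trees with `i` left and `j` right vertices. -/
def shapeSet (i j : ℕ) : Finset (BinaryTree Unit) :=
  (BinaryTree.treesOfNumNodesEq (i + j + 1)).filter fun B => (children .left B).card = i

theorem mem_shapeSet {i j : ℕ} {B : BinaryTree Unit} :
    B ∈ shapeSet i j ↔ B ≠ .nil ∧ (children .left B).card = i ∧ (children .right B).card = j := by
  rw [shapeSet, mem_filter, BinaryTree.mem_treesOfNumNodesEq]
  constructor
  · rintro ⟨h, hi⟩
    have hB : B ≠ .nil := by rintro rfl; simp at h
    have := card_children_add hB
    exact ⟨hB, hi, by omega⟩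
  · rintro ⟨hB, hi, hj⟩
    have := card_children_add hB
    exact ⟨by omega, hi⟩

/-- The binary trees contributing `i` left and `j` right vertices when they hang on side `s`. -/
def hangSet (s : Side) (i j : ℕ) : Finset (BinaryTree Unit) :=
  (BinaryTree.treesOfNumNodesEq (i + j)).filter fun B => (hang .left s B).card = i

theorem mem_hangSet {s : Side} {i j : ℕ} {B : BinaryTree Unit} :
    B ∈ hangSet s i j ↔ (hang .left s B).card = i ∧ (hang .right s B).card = j := by
  rw [hangSet, mem_filter, BinaryTree.mem_treesOfNumNodesEq]
  have := card_hang_add s B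
  constructor <;> rintro ⟨h, h'⟩ <;> constructor <;> omega

/-- A non-empty tree hung on the left has one more left vertex, its root. This index shift becomes
differentiation of the series. -/
theorem hangSet_left_succ (i j : ℕ) : hangSet .left (i + 1) j = shapeSet i j := by
  ext B
  rw [mem_hangSet, mem_shapeSet]
  by_cases h : B = .nil
  · subst h
    simp [hang_nil]
  · rw [card_hang_self _ h, card_hang_of_ne (by decide)]
    simp [h]

theorem hangSet_right_succ (i j : ℕ) : hangSet .right i (j + 1) = shapeSet i j := by
  ext B
  rw [mem_hangSet, mem_shapeSet]
  by_cases h : B = .nil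
  · subst h
    simp [hang_nil]
  · rw [card_hang_self _ h, card_hang_of_ne (by decide)]
    simp [h]

/-- Only the empty tree adds no left vertex when hung on the left; this provides the initial
condition at x = 0. -/
theorem hangSet_left_zero (j : ℕ) : hangSet .left 0 j = if j = 0 then {.nil} else ∅ := by
  ext B
  rw [mem_hangSet]
  by_cases h : B = .nil
  · subst h
    rcases eq_or_ne j 0 with rfl | hj
    · simp [hang_nil]
    · simp [hang_nil, hj, hj.symm]
  · rw [card_hang_self _ h]
    split_ifs <;> simp [h]

theorem hangSet_right_zero (i : ℕ) : hangSet .right i 0 = if i = 0 then {.nil} else ∅ := by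
  ext B
  rw [mem_hangSet]
  by_cases h : B = .nil
  · subst h
    rcases eq_or_ne i 0 with rfl | hj
    · simp [hang_nil]
    · simp [hang_nil, hj, hj.symm]
  · rw [card_hang_self _ h]
    split_ifs <;> simp [h]

/-- A non-empty tree is a pair of hanging subtrees whose vertex counts add up. The sums are nested
as in `coeff₂_mul`, to be read as a product of series. -/
theorem sum_shapeSet {R : Type*} [CommSemiring R] (f g : BinaryTree Unit → R)
    (φ : BinaryTree Unit → R) (hφ : ∀ a l r, φ (.node a l r) = f l * g r) (i j : ℕ) :
    ∑ B ∈ shapeSet i j, φ B = ∑ q ∈ antidiagonal j, ∑ p ∈ antidiagonal i,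
      (∑ l ∈ hangSet .left p.1 q.1, f l) * ∑ r ∈ hangSet .right p.2 q.2, g r := by
  simp only [sum_mul_sum]
  simp only [← sum_product']
  rw [sum_sigma']
  symm
  refine sum_bij (fun x _ => .node () x.2.1 x.2.2) ?_ ?_ ?_ ?_
  · rintro ⟨⟨q, p⟩, l, r⟩ h
    simp only [mem_sigma, HasAntidiagonal.mem_antidiagonal, mem_product, mem_hangSet] at h
    rw [mem_shapeSet, card_children_node, card_children_node]
    refine ⟨by simp, ?_, ?_⟩ <;> dsimp only <;> omega
  · rintro ⟨⟨⟨q, q'⟩, p, p'⟩, l, r⟩ h ⟨⟨⟨u, u'⟩, v, v'⟩, l', r'⟩ h' e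
    simp only [mem_sigma, HasAntidiagonal.mem_antidiagonal, mem_product, mem_hangSet] at h h'
    obtain ⟨-, ⟨rfl, rfl⟩, rfl, rfl⟩ := h
    obtain ⟨-, ⟨rfl, rfl⟩, rfl, rfl⟩ := h'
    cases e
    rfl
  · intro B hB
    obtain ⟨hB, hi, hj⟩ := mem_shapeSet.1 hB
    cases B with
    | nil => exact absurd rfl hB
    | node a l r =>
      rw [card_children_node] at hi hj
      refine ⟨⟨⟨((hang .right .left l).card, (hang .right .right r).card),
        (hang .left .left l).card, (hang .left .right r).card⟩, l, r⟩, ?_, rfl⟩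
      simp [mem_hangSet, hi, hj]
  · rintro ⟨⟨q, p⟩, l, r⟩ -
    exact (hφ _ _ _).symm

end Shapes

/-! ### Multiplicative weights on shapes. -/

section Weights

/-- The number of labellings of `B`, divided by the factorials of the numbers of its left and
right vertices. -/
noncomputable def labelDensity (B : BinaryTree Unit) : ℚ :=
  (linExt IsAncestor (children .left B) / (children .left B).card.factorial) *
    (linExt IsAncestor (children .right B) / (children .right B).card.factorial)

/-- The label density of `B` together with the edge by which it hangs on side `s`. -/
noncomputable def hangDensity (s : Side) (B : BinaryTree Unit) : ℚ :=
  (linExt IsAncestor (children .left B) / (hang .left s B).card.factorial) *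
    (linExt IsAncestor (children .right B) / (hang .right s B).card.factorial)

/-- The factorials absorb the binomial coefficients of `linExt_children_node`. -/
theorem labelDensity_node (a : Unit) (l r : BinaryTree Unit) :
    labelDensity (.node a l r) = hangDensity .left l * hangDensity .right r := by
  have key : ∀ (m n : ℕ) (x y : ℚ), ((m + n).choose m : ℚ) * (x * y) / (m + n).factorial =
      x / m.factorial * (y / n.factorial) := by
    intro m n x y
    rw [Nat.choose_symm_add, Nat.add_choose, Nat.cast_div (Nat.factorial_mul_factorial_dvd_factorial_add m n)
      (by positivity)]
    push_cast
    field_simp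
  rw [labelDensity, linExt_children_node, linExt_children_node, card_children_node,
    card_children_node]
  push_cast
  rw [key, key, hangDensity, hangDensity]
  ring

theorem hangDensity_nil (s : Side) : hangDensity s .nil = 1 := by
  simp [hangDensity, hang_nil, children_nil, linExt_empty]

theorem hangDensity_left {B : BinaryTree Unit} (hB : B ≠ .nil) :
    ((children .left B).card + 1 : ℚ) * hangDensity .left B = labelDensity B := by
  rw [hangDensity, labelDensity, card_hang_self _ hB, card_hang_of_ne (by decide),
    Nat.factorial_succ]
  push_cast
  field_simp

theorem hangDensity_right {B : BinaryTree Unit} (hB : B ≠ .nil) :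
    ((children .right B).card + 1 : ℚ) * hangDensity .right B = labelDensity B := by
  rw [hangDensity, labelDensity, card_hang_self _ hB, card_hang_of_ne (by decide),
    Nat.factorial_succ]
  push_cast
  field_simp

/-- The number of vertices of `B` in the branch on side `s` of its root, the root included. -/
noncomputable def branchLength (s : Side) (B : BinaryTree Unit) : ℕ :=
  if B = .nil then 0 else rootBranchCount s B + 1

theorem rootBranchCount_node_left (a : Unit) (l r : BinaryTree Unit) :
    rootBranchCount .left (.node a l r) = branchLength .left l := by
  rw [branchLength]
  split_ifs with h
  · exact rootBranchCount_eq_zero _ h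
  · exact rootBranchCount_eq (B := .node a l r) .left h

theorem rootBranchCount_node_right (a : Unit) (l r : BinaryTree Unit) :
    rootBranchCount .right (.node a l r) = branchLength .right r := by
  rw [branchLength]
  split_ifs with h
  · exact rootBranchCount_eq_zero _ h
  · exact rootBranchCount_eq (B := .node a l r) .right h

/-- The weight of a tree whose root has position `q` in its hook. -/
noncomputable def shapeWeight (t : ℚ) (q : Option Side) (a b : ℚ) (B : BinaryTree Unit) : ℚ :=
  t ^ hookStarts q B * (a ^ rootBranchCount .left B * b ^ rootBranchCount .right B) *
    labelDensity B

/-- The contribution to the weight of a tree of a subtree of its root on side `s`. -/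
noncomputable def hangWeight (t : ℚ) (s : Side) (q : Option Side) (a : ℚ) (B : BinaryTree Unit) :
    ℚ :=
  t ^ hookStarts q B * a ^ branchLength s B * hangDensity s B

theorem shapeWeight_node (t : ℚ) (q : Option Side) (a b : ℚ) (u : Unit) (l r : BinaryTree Unit) :
    shapeWeight t q a b (.node u l r) = ((if q = none then t else 1) *
      hangWeight t .left (hookStep q .left) a l) * hangWeight t .right (hookStep q .right) b r := by
  rw [shapeWeight, labelDensity_node, rootBranchCount_node_left, rootBranchCount_node_right,
    hookStarts, hangWeight, hangWeight, pow_add, pow_add]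
  split_ifs <;> ring

theorem hangWeight_nil (t : ℚ) (s : Side) (q : Option Side) (a : ℚ) :
    hangWeight t s q a .nil = 1 := by
  simp [hangWeight, hookStarts, branchLength, hangDensity_nil]

/-- The root of `B` adds one vertex to the marked branch, which gives the factor `a`. The right
branch of that root is not the one at the root of the whole tree, so its mark is 1. -/
theorem hangWeight_left (t : ℚ) (q : Option Side) (a : ℚ) {B : BinaryTree Unit} (hB : B ≠ .nil) :
    hangWeight t .left q a B * ((children .left B).card + 1) = a * shapeWeight t q a 1 B := by
  rw [hangWeight, shapeWeight, ← hangDensity_left hB, branchLength, if_neg hB, pow_succ, one_pow]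
  ring

theorem hangWeight_right (t : ℚ) (q : Option Side) (b : ℚ) {B : BinaryTree Unit} (hB : B ≠ .nil) :
    hangWeight t .right q b B * ((children .right B).card + 1) = b * shapeWeight t q 1 b B := by
  rw [hangWeight, shapeWeight, ← hangDensity_right hB, branchLength, if_neg hB, pow_succ, one_pow]
  ring

end Weights

/-! ### Formal power series in two variables and their partial derivatives. -/

section Bivariate

open PowerSeries

/-- The coefficient of `x ^ i * y ^ j`, where `x` is the inner and `y` the outer variable. -/
noncomputable def coeff₂ (i j : ℕ) (f : ℚ⟦X⟧⟦X⟧) : ℚ := coeff i (coeff j f)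

theorem coeff₂_mul (i j : ℕ) (f g : ℚ⟦X⟧⟦X⟧) :
    coeff₂ i j (f * g) = ∑ q ∈ antidiagonal j, ∑ p ∈ antidiagonal i,
      coeff₂ p.1 q.1 f * coeff₂ p.2 q.2 g := by
  simp only [coeff₂, coeff_mul, map_sum]

/-- The derivative with respect to the inner variable, as an additive map. -/
noncomputable def derivInnerHom : ℚ⟦X⟧⟦X⟧ →+ ℚ⟦X⟧⟦X⟧ where
  toFun f := PowerSeries.mk fun j => d⁄dX ℚ (coeff j f)
  map_zero' := by ext; simp
  map_add' f g := by ext; simp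

theorem coeff_derivInnerHom (j : ℕ) (f : ℚ⟦X⟧⟦X⟧) :
    coeff j (derivInnerHom f) = d⁄dX ℚ (coeff j f) :=
  PowerSeries.coeff_mk j fun j => d⁄dX ℚ (coeff j f)

/-- An additive map that satisfies the product rule, as a derivation. -/
def derivationOfLeibniz {A : Type*} [CommRing A] (D : A →+ A)
    (h : ∀ f g, D (f * g) = f * D g + g * D f) : Derivation ℤ A A :=
  Derivation.mk' D.toIntLinearMap h

theorem derivInnerHom_mul (f g : ℚ⟦X⟧⟦X⟧) :
    derivInnerHom (f * g) = f * derivInnerHom g + g * derivInnerHom f := by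
  ext j : 1
  simp only [coeff_derivInnerHom, smul_eq_mul, map_add, coeff_mul, map_sum, Derivation.leibniz,
    sum_add_distrib]
  congr 1
  rw [← Finset.Nat.sum_antidiagonal_swap]
  rfl

/-- The derivative with respect to the inner variable. -/
noncomputable def derivInner := derivationOfLeibniz derivInnerHom derivInnerHom_mul

theorem coeff_derivInner (j : ℕ) (f : ℚ⟦X⟧⟦X⟧) :
    coeff j (derivInner f) = d⁄dX ℚ (coeff j f) := coeff_derivInnerHom j f

theorem coeff₂_derivInner (i j : ℕ) (f : ℚ⟦X⟧⟦X⟧) :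
    coeff₂ i j (derivInner f) = coeff₂ (i + 1) j f * (i + 1) := by
  rw [coeff₂, coeff_derivInner, coeff_derivative, coeff₂]

/-- The derivative of power series, as a derivation over the integers. -/
noncomputable def intDerivative (A : Type*) [CommRing A] :=
  derivationOfLeibniz (d⁄dX A : A⟦X⟧ →+ A⟦X⟧) fun f g => (d⁄dX A).leibniz f g

theorem coeff_intDerivative {A : Type*} [CommRing A] (n : ℕ) (f : A⟦X⟧) :
    coeff n (intDerivative A f) = coeff (n + 1) f * (n + 1) :=
  coeff_derivative f n

theorem intDerivative_C {A : Type*} [CommRing A] (a : A) :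
    intDerivative A (PowerSeries.C a) = 0 :=
  derivative_C

/-- The derivative with respect to the outer variable. -/
noncomputable def derivOuter := intDerivative ℚ⟦X⟧

theorem coeff₂_derivOuter (i j : ℕ) (f : ℚ⟦X⟧⟦X⟧) :
    coeff₂ i j (derivOuter f) = coeff₂ i (j + 1) f * (j + 1) := by
  have h : ((j : ℚ⟦X⟧) + 1) = PowerSeries.C (j + 1 : ℚ) := by simp
  rw [coeff₂, derivOuter, coeff_intDerivative, h, coeff_mul_C, coeff₂]

/-- The coefficients of two power series agree in total degree less than `n`. -/
def Agree (n : ℕ) (f g : ℚ⟦X⟧⟦X⟧) : Prop := ∀ i j, i + j < n → coeff₂ i j f = coeff₂ i j g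

theorem Agree.refl (n : ℕ) (f : ℚ⟦X⟧⟦X⟧) : Agree n f f := fun _ _ _ => rfl

theorem Agree.mul {n : ℕ} {f f' g g' : ℚ⟦X⟧⟦X⟧} (hf : Agree n f f') (hg : Agree n g g') :
    Agree n (f * g) (f' * g') := by
  intro i j hij
  rw [coeff₂_mul, coeff₂_mul]
  refine sum_congr rfl fun q hq => sum_congr rfl fun p hp => ?_
  rw [HasAntidiagonal.mem_antidiagonal] at hp hq
  rw [hf _ _ (by omega), hg _ _ (by omega)]

/-- Integration gains one degree: coefficients with positive x-exponent come from the derivative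
after division by that exponent, the others from the value at x = 0. -/
theorem Agree.of_derivInner {n : ℕ} {f g : ℚ⟦X⟧⟦X⟧} (h : Agree n (derivInner f) (derivInner g))
    (h0 : PowerSeries.map constantCoeff f = PowerSeries.map constantCoeff g) :
    Agree (n + 1) f g := by
  intro i j hij
  cases i with
  | zero => simpa [coeff₂] using congrArg (coeff j) h0
  | succ i =>
    have := h i j (by omega)
    rw [coeff₂_derivInner, coeff₂_derivInner] at this
    exact mul_right_cancel₀ (by positivity) this

theorem Agree.of_derivOuter {n : ℕ} {f g : ℚ⟦X⟧⟦X⟧} (h : Agree n (derivOuter f) (derivOuter g))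
    (h0 : constantCoeff f = constantCoeff g) : Agree (n + 1) f g := by
  intro i j hij
  cases j with
  | zero => simpa [coeff₂] using congrArg (coeff i) h0
  | succ j =>
    have := h i j (by omega)
    rw [coeff₂_derivOuter, coeff₂_derivOuter] at this
    exact mul_right_cancel₀ (by positivity) this

theorem eq_of_agree {f g : ℚ⟦X⟧⟦X⟧} (h : ∀ n, Agree n f g) : f = g := by
  ext j i
  exact h (i + j + 1) i j (by omega)

/-- A rational constant. -/
noncomputable def const (c : ℚ) : ℚ⟦X⟧⟦X⟧ := PowerSeries.C (PowerSeries.C c)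

theorem coeff₂_const_mul (c : ℚ) (f : ℚ⟦X⟧⟦X⟧) (i j : ℕ) :
    coeff₂ i j (const c * f) = c * coeff₂ i j f := by
  rw [coeff₂, const, coeff_C_mul, coeff_C_mul, coeff₂]

theorem derivInner_const (c : ℚ) : derivInner (const c) = 0 := by
  ext j : 1
  rw [coeff_derivInner, const, coeff_C]
  split_ifs <;> simp

theorem derivOuter_const (c : ℚ) : derivOuter (const c) = 0 := by
  rw [derivOuter, const, intDerivative_C]

/-- The exponential series of the inner variable. -/
noncomputable def expInner : ℚ⟦X⟧⟦X⟧ := PowerSeries.C (PowerSeries.exp ℚ)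

/-- The exponential series of the outer variable. -/
noncomputable def expOuter : ℚ⟦X⟧⟦X⟧ := PowerSeries.map PowerSeries.C (PowerSeries.exp ℚ)

theorem derivInner_expInner : derivInner expInner = expInner := by
  ext j : 1
  rw [coeff_derivInner, expInner, coeff_C]
  split_ifs
  · rw [derivative_exp]
  · simp

theorem derivOuter_expInner : derivOuter expInner = 0 := by
  rw [derivOuter, expInner, intDerivative_C]

theorem derivInner_expOuter : derivInner expOuter = 0 := by
  ext j : 1
  rw [coeff_derivInner, expOuter, coeff_map, derivative_C, map_zero]

theorem derivOuter_expOuter : derivOuter expOuter = expOuter := by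
  ext j : 1
  have h : ((j : ℚ⟦X⟧) + 1) = PowerSeries.C (j + 1 : ℚ) := by simp
  have h' := congrArg (coeff j) (derivative_exp ℚ)
  rw [coeff_derivative] at h'
  rw [derivOuter, coeff_intDerivative, h, expOuter, coeff_map, coeff_map, ← map_mul, h']

theorem map_constantCoeff_expInner : PowerSeries.map constantCoeff expInner = 1 := by
  simp [expInner]

theorem constantCoeff_expOuter : constantCoeff expOuter = 1 := by
  simp [expOuter]

theorem coeff₂_C_mul_map_C (f g : ℚ⟦X⟧) (i j : ℕ) :
    coeff₂ i j (PowerSeries.C f * PowerSeries.map PowerSeries.C g) = coeff i f * coeff j g := by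
  rw [coeff₂, coeff_C_mul, coeff_map, coeff_mul_C]

/-- The inverse of `1 - t * (e ^ x - 1) * (e ^ y - 1)`. -/
noncomputable def geom (t : ℚ) : ℚ⟦X⟧⟦X⟧ :=
  PowerSeries.invOfUnit (1 - const t * (expInner - 1) * (expOuter - 1)) 1

theorem geom_spec (t : ℚ) : geom t * (1 - const t * (expInner - 1) * (expOuter - 1)) = 1 := by
  rw [mul_comm]
  exact PowerSeries.mul_invOfUnit _ _ (by simp [constantCoeff_expOuter])

/-- Differentiate `hu` and multiply by `u`. An abstract derivation lets one computation serve both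
variables. -/
theorem derivation_geom {A : Type*} [CommRing A] (D : Derivation ℤ A A) {u t x y : A}
    (hu : u * (1 - t * (x - 1) * (y - 1)) = 1) (ht : D t = 0) :
    D u = u ^ 2 * t * (D x * (y - 1) + (x - 1) * D y) := by
  have h := congrArg D hu
  simp only [Derivation.leibniz, map_sub, Derivation.map_one_eq_zero, ht, smul_eq_mul] at h
  linear_combination u * h - D u * hu

theorem map_constantCoeff_geom (t : ℚ) : PowerSeries.map constantCoeff (geom t) = 1 := by
  have h := congrArg (PowerSeries.map (constantCoeff (R := ℚ))) (geom_spec t)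
  simpa [map_constantCoeff_expInner] using h

theorem constantCoeff_geom (t : ℚ) : constantCoeff (geom t) = 1 := by
  have h := congrArg constantCoeff (geom_spec t)
  simpa [constantCoeff_expOuter] using h

end Bivariate

/-! ### The differential system for the tree series and its closed solution. -/

section GeneratingSeries

open PowerSeries

/-- The generating series of the non-empty binary trees weighted by `φ`. -/
noncomputable def shapeSeries (φ : BinaryTree Unit → ℚ) : ℚ⟦X⟧⟦X⟧ :=
  PowerSeries.mk fun j => PowerSeries.mk fun i => ∑ B ∈ shapeSet i j, φ B

/-- The generating series of the binary trees that hang on side `s`, weighted by `f`. -/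
noncomputable def hangSeries (s : Side) (f : BinaryTree Unit → ℚ) : ℚ⟦X⟧⟦X⟧ :=
  PowerSeries.mk fun j => PowerSeries.mk fun i => ∑ B ∈ hangSet s i j, f B

theorem coeff₂_shapeSeries (φ : BinaryTree Unit → ℚ) (i j : ℕ) :
    coeff₂ i j (shapeSeries φ) = ∑ B ∈ shapeSet i j, φ B := by
  rw [coeff₂, shapeSeries, PowerSeries.coeff_mk, PowerSeries.coeff_mk]

theorem coeff₂_hangSeries (s : Side) (f : BinaryTree Unit → ℚ) (i j : ℕ) :
    coeff₂ i j (hangSeries s f) = ∑ B ∈ hangSet s i j, f B := by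
  rw [coeff₂, hangSeries, PowerSeries.coeff_mk, PowerSeries.coeff_mk]

theorem ext_coeff₂ {f g : ℚ⟦X⟧⟦X⟧} (h : ∀ i j, coeff₂ i j f = coeff₂ i j g) : f = g :=
  eq_of_agree fun _ i j _ => h i j

theorem shapeSeries_eq_mul {f g φ : BinaryTree Unit → ℚ}
    (hφ : ∀ a l r, φ (.node a l r) = f l * g r) :
    shapeSeries φ = hangSeries .left f * hangSeries .right g := by
  refine ext_coeff₂ fun i j => ?_
  rw [coeff₂_shapeSeries, sum_shapeSet f g φ hφ, coeff₂_mul]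
  simp only [coeff₂_hangSeries]

theorem hangSeries_const_mul (s : Side) (c : ℚ) (f : BinaryTree Unit → ℚ) :
    hangSeries s (fun B => c * f B) = const c * hangSeries s f := by
  refine ext_coeff₂ fun i j => ?_
  rw [coeff₂_const_mul, coeff₂_hangSeries, coeff₂_hangSeries, mul_sum]

theorem shapeSeries_const_mul (c : ℚ) (f : BinaryTree Unit → ℚ) :
    shapeSeries (fun B => c * f B) = const c * shapeSeries f := by
  refine ext_coeff₂ fun i j => ?_
  rw [coeff₂_const_mul, coeff₂_shapeSeries, coeff₂_shapeSeries, mul_sum]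

theorem map_constantCoeff_hangSeries {f : BinaryTree Unit → ℚ} (hf : f .nil = 1) :
    PowerSeries.map constantCoeff (hangSeries .left f) = 1 := by
  ext j
  have h := coeff₂_hangSeries .left f 0 j
  rw [coeff₂, coeff_zero_eq_constantCoeff_apply, hangSet_left_zero] at h
  rw [coeff_map, h, coeff_one]
  split_ifs <;> simp [hf]

theorem constantCoeff_hangSeries {f : BinaryTree Unit → ℚ} (hf : f .nil = 1) :
    constantCoeff (hangSeries .right f) = 1 := by
  ext i
  have h := coeff₂_hangSeries .right f i 0
  rw [coeff₂, coeff_zero_eq_constantCoeff_apply, hangSet_right_zero] at h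
  rw [h, coeff_one]
  split_ifs <;> simp [hf]

theorem derivInner_hangSeries {f φ : BinaryTree Unit → ℚ}
    (h : ∀ B, B ≠ .nil → f B * ((children .left B).card + 1) = φ B) :
    derivInner (hangSeries .left f) = shapeSeries φ := by
  refine ext_coeff₂ fun i j => ?_
  rw [coeff₂_derivInner, coeff₂_hangSeries, coeff₂_shapeSeries, hangSet_left_succ, sum_mul]
  refine sum_congr rfl fun B hB => ?_
  obtain ⟨hB, hi, -⟩ := mem_shapeSet.1 hB
  rw [← h B hB, hi]

theorem derivOuter_hangSeries {f φ : BinaryTree Unit → ℚ}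
    (h : ∀ B, B ≠ .nil → f B * ((children .right B).card + 1) = φ B) :
    derivOuter (hangSeries .right f) = shapeSeries φ := by
  refine ext_coeff₂ fun i j => ?_
  rw [coeff₂_derivOuter, coeff₂_hangSeries, coeff₂_shapeSeries, hangSet_right_succ, sum_mul]
  refine sum_congr rfl fun B hB => ?_
  obtain ⟨hB, -, hj⟩ := mem_shapeSet.1 hB
  rw [← h B hB, hj]

variable (t : ℚ)

theorem shapeSeries_shapeWeight (q : Option Side) (a b : ℚ) :
    shapeSeries (shapeWeight t q a b) = const (if q = none then t else 1) *
      hangSeries .left (hangWeight t .left (hookStep q .left) a) *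
      hangSeries .right (hangWeight t .right (hookStep q .right) b) := by
  rw [shapeSeries_eq_mul (shapeWeight_node t q a b), hangSeries_const_mul]

theorem const_one : const 1 = 1 := by simp [const]

theorem const_natCast (n : ℕ) : const n = n := by simp [const]

/-- The left subtrees of a vertex from which a hook starts or which is in a left branch. -/
noncomputable def leftSeries (a : ℚ) : ℚ⟦X⟧⟦X⟧ :=
  hangSeries .left (hangWeight t .left (some .left) a)

/-- The right subtrees of a vertex from which a hook starts or which is in a right branch. -/
noncomputable def rightSeries (b : ℚ) : ℚ⟦X⟧⟦X⟧ :=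
  hangSeries .right (hangWeight t .right (some .right) b)

/-- The left subtrees of the other vertices of right branches. -/
noncomputable def innerLeftSeries : ℚ⟦X⟧⟦X⟧ := hangSeries .left (hangWeight t .left none 1)

/-- The right subtrees of the other vertices of left branches. -/
noncomputable def innerRightSeries : ℚ⟦X⟧⟦X⟧ := hangSeries .right (hangWeight t .right none 1)

theorem shapeSeries_root (a b : ℚ) :
    shapeSeries (shapeWeight t none a b) = const t * leftSeries t a * rightSeries t b :=
  shapeSeries_shapeWeight t none a b

/-- The root of a subtree that continues a left branch has a left subtree that continues it further
and a right subtree that starts a new hook. -/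
theorem derivInner_leftSeries (a : ℚ) :
    derivInner (leftSeries t a) = const a * (leftSeries t a * innerRightSeries t) := by
  rw [leftSeries, derivInner_hangSeries fun B hB => hangWeight_left t (some .left) a hB,
    shapeSeries_const_mul, shapeSeries_shapeWeight, if_neg (by simp), const_one, one_mul]
  rfl

theorem derivOuter_rightSeries (b : ℚ) :
    derivOuter (rightSeries t b) = const b * (innerLeftSeries t * rightSeries t b) := by
  rw [rightSeries, derivOuter_hangSeries fun B hB => hangWeight_right t (some .right) b hB,
    shapeSeries_const_mul, shapeSeries_shapeWeight, if_neg (by simp), const_one, one_mul]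
  rfl

/-- Here the root starts a hook, so it contributes `t`, and both its subtrees continue a branch of
that hook. -/
theorem derivInner_innerLeftSeries :
    derivInner (innerLeftSeries t) = const t * leftSeries t 1 * rightSeries t 1 := by
  rw [innerLeftSeries, derivInner_hangSeries fun B hB => hangWeight_left t none 1 hB,
    shapeSeries_const_mul, shapeSeries_root, const_one, one_mul]

theorem derivOuter_innerRightSeries :
    derivOuter (innerRightSeries t) = const t * leftSeries t 1 * rightSeries t 1 := by
  rw [innerRightSeries, derivOuter_hangSeries fun B hB => hangWeight_right t none 1 hB,
    shapeSeries_const_mul, shapeSeries_root, const_one, one_mul]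

theorem derivation_pow {A : Type*} [CommRing A] (D : Derivation ℤ A A) {f c : A}
    (h : D f = f * c) (n : ℕ) : D (f ^ n) = n * (f ^ n * c) := by
  rw [Derivation.leibniz_pow, h]
  cases n with
  | zero => simp
  | succ n =>
    rw [Nat.add_sub_cancel, smul_eq_mul, nsmul_eq_mul]
    ring

theorem derivation_exp_mul_geom {A : Type*} [CommRing A] (D : Derivation ℤ A A) {u t x y : A}
    (hu : u * (1 - t * (x - 1) * (y - 1)) = 1) (ht : D t = 0) (hx : D x = x) (hy : D y = 0) :
    D (x * u) = x * u * (1 + t * x * (y - 1) * u) := by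
  rw [Derivation.leibniz, derivation_geom D hu ht, hx, hy, smul_eq_mul, smul_eq_mul]
  ring

theorem derivation_one_add {A : Type*} [CommRing A] (D : Derivation ℤ A A) {u t x y : A}
    (hu : u * (1 - t * (x - 1) * (y - 1)) = 1) (ht : D t = 0) (hx : D x = x) (hy : D y = 0) :
    D (1 + t * y * (x - 1) * u) = t * (x * u) * (y * u) := by
  simp only [Derivation.leibniz, map_add, map_sub, Derivation.map_one_eq_zero, ht, hx, hy,
    derivation_geom D hu ht, smul_eq_mul]
  linear_combination (-(t * x * y * u)) * hu

theorem geom_spec_symm :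
    geom t * (1 - const t * (expOuter - 1) * (expInner - 1)) = 1 := by
  rw [mul_right_comm (const t), geom_spec]

/-- The closed forms satisfy the same differential system and the same initial conditions. Agreement
below degree n makes the derivatives agree below degree n, and integrating gives degree n + 1. All
four series must be treated together because the equations are coupled. -/
theorem agree_closed (n : ℕ) :
    (∀ a : ℕ, Agree n (leftSeries t a) ((expInner * geom t) ^ a)) ∧
    (∀ b : ℕ, Agree n (rightSeries t b) ((expOuter * geom t) ^ b)) ∧
    Agree n (innerLeftSeries t) (1 + const t * expOuter * (expInner - 1) * geom t) ∧
    Agree n (innerRightSeries t) (1 + const t * expInner * (expOuter - 1) * geom t) := by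
  induction n with
  | zero => simp [Agree]
  | succ n ih =>
    obtain ⟨hl, hr, hil, hir⟩ := ih
    -- The equations of the two inner series involve the branch series with mark 1.
    have hl1 := hl 1
    have hr1 := hr 1
    rw [Nat.cast_one, pow_one] at hl1 hr1
    refine ⟨fun a => Agree.of_derivInner ?_ ?_, fun b => Agree.of_derivOuter ?_ ?_,
      Agree.of_derivInner ?_ ?_, Agree.of_derivOuter ?_ ?_⟩
    · rw [derivInner_leftSeries, derivation_pow _ (derivation_exp_mul_geom _ (geom_spec t)
        (derivInner_const t) derivInner_expInner derivInner_expOuter), const_natCast]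
      exact (Agree.refl _ _).mul ((hl a).mul hir)
    · rw [leftSeries, map_constantCoeff_hangSeries (hangWeight_nil _ _ _ _), map_pow, map_mul,
        map_constantCoeff_expInner, map_constantCoeff_geom, one_mul, one_pow]
    · rw [derivOuter_rightSeries, derivation_pow _ (derivation_exp_mul_geom _ (geom_spec_symm t)
        (derivOuter_const t) derivOuter_expOuter derivOuter_expInner), const_natCast,
        mul_comm (innerLeftSeries t)]
      exact (Agree.refl _ _).mul ((hr b).mul hil)
    · rw [rightSeries, constantCoeff_hangSeries (hangWeight_nil _ _ _ _), map_pow, map_mul,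
        constantCoeff_expOuter, constantCoeff_geom, one_mul, one_pow]
    · rw [derivInner_innerLeftSeries, derivation_one_add _ (geom_spec t) (derivInner_const t)
        derivInner_expInner derivInner_expOuter]
      exact ((Agree.refl _ _).mul hl1).mul hr1
    · rw [innerLeftSeries, map_constantCoeff_hangSeries (hangWeight_nil _ _ _ _)]
      simp [map_constantCoeff_expInner]
    · rw [derivOuter_innerRightSeries, derivation_one_add _ (geom_spec_symm t) (derivOuter_const t)
        derivOuter_expOuter derivOuter_expInner, mul_right_comm]
      exact ((Agree.refl _ _).mul hr1).mul hl1
    · rw [innerRightSeries, constantCoeff_hangSeries (hangWeight_nil _ _ _ _)]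
      simp [constantCoeff_expOuter]

theorem shapeSeries_eq (a b : ℕ) :
    shapeSeries (shapeWeight t none a b) =
      const t * (expInner * geom t) ^ a * (expOuter * geom t) ^ b := by
  rw [shapeSeries_root, eq_of_agree fun n => (agree_closed t n).1 a,
    eq_of_agree fun n => (agree_closed t n).2.1 b]

/-- This is the binomial series of (1 - z)^(-N) with an explicit remainder, so that no infinite sum
is needed. Multiplying the truncated series for N + 1 by 1 - z gives the one for N up to a multiple
of z^M, by the Pascal rule for `multichoose`. -/
theorem geom_pow_eq {A : Type*} [CommRing A] {u z : A} (hu : u * (1 - z) = 1) (N M : ℕ) :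
    ∃ c, u ^ N = ∑ m ∈ range M, (N.multichoose m : A) * z ^ m + z ^ M * c := by
  induction N with
  | zero =>
    cases M with
    | zero => exact ⟨1, by simp⟩
    | succ M => exact ⟨0, by simp [sum_range_succ']⟩
  | succ N ih =>
    obtain ⟨c, hc⟩ := ih
    have key : ∀ M, ∃ d, (1 - z) * ∑ m ∈ range M, ((N + 1).multichoose m : A) * z ^ m =
        ∑ m ∈ range M, (N.multichoose m : A) * z ^ m + z ^ M * d := by
      intro M
      induction M with
      | zero => exact ⟨0, by simp⟩
      | succ M ih =>
        refine ⟨-((N + 1).multichoose M : A), ?_⟩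
        -- The existential hypothesis hides its witness; the induction is redone for the explicit
        -- remainder.
        clear ih
        induction M with
        | zero => simp; ring
        | succ M ih =>
          rw [sum_range_succ, mul_add, ih, sum_range_succ _ (M + 1), Nat.multichoose_succ_succ]
          push_cast
          ring
    obtain ⟨d, hd⟩ := key M
    refine ⟨u * (c - d), ?_⟩
    rw [pow_succ, hc]
    linear_combination (∑ m ∈ range M, ((N + 1).multichoose m : A) * z ^ m) * hu - u * hd

/-- With F_m = e^(ax) (e^x - 1)^m one has F_m' = (a + m) F_m + m F_(m-1), which is the recursion of
`qStirling_succ_succ` up to factorials. For m = 0 the truncated `m - 1` is harmless because its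
factor vanishes. -/
theorem coeff_exp_pow_mul (a n m : ℕ) :
    coeff n (PowerSeries.exp ℚ ^ a * (PowerSeries.exp ℚ - 1) ^ m) =
      m.factorial / n.factorial * qStirling (a : ℚ) (n + 1) (m + 1) := by
  induction n generalizing m with
  | zero =>
    rw [zero_add, qStirling_one]
    cases m with
    | zero => simp
    | succ m => simp
  | succ n ih =>
    have hd : d⁄dX ℚ (PowerSeries.exp ℚ ^ a * (PowerSeries.exp ℚ - 1) ^ m) =
        PowerSeries.C (a + m : ℚ) * (PowerSeries.exp ℚ ^ a * (PowerSeries.exp ℚ - 1) ^ m) +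
        PowerSeries.C (m : ℚ) * (PowerSeries.exp ℚ ^ a * (PowerSeries.exp ℚ - 1) ^ (m - 1)) := by
      have h1 : d⁄dX ℚ (PowerSeries.exp ℚ - 1) = PowerSeries.exp ℚ := by
        rw [map_sub, derivative_exp, Derivation.map_one_eq_zero, sub_zero]
      have h2 : d⁄dX ℚ (PowerSeries.exp ℚ ^ a) = a * PowerSeries.exp ℚ ^ a := by
        rw [Derivation.leibniz_pow, derivative_exp]
        cases a with
        | zero => simp
        | succ a =>
          rw [Nat.add_sub_cancel, smul_eq_mul, nsmul_eq_mul]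
          ring
      rw [Derivation.leibniz, h2, Derivation.leibniz_pow, h1]
      simp only [smul_eq_mul, nsmul_eq_mul, map_add, map_natCast]
      cases m with
      | zero => simp
      | succ m =>
        rw [Nat.add_sub_cancel]
        ring
    have h := congrArg (coeff n) hd
    rw [coeff_derivative, map_add, coeff_C_mul, coeff_C_mul, ih, ih] at h
    have hn : ((n : ℚ) + 1) ≠ 0 := by positivity
    rw [eq_div_of_mul_eq hn h, qStirling_succ_succ, Nat.factorial_succ n]
    push_cast
    cases m with
    | zero =>
      rw [qStirling_succ_zero]
      field_simp
      simp [mul_comm]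
    | succ m =>
      rw [Nat.add_sub_cancel, Nat.factorial_succ]
      push_cast
      field_simp

theorem coeff₂_closed (a b w h M : ℕ) (hM : h < M) :
    coeff₂ w h ((expInner * geom t) ^ a * (expOuter * geom t) ^ b) =
      ∑ m ∈ range M, ((a + b).multichoose m * t ^ m) *
        ((m.factorial / w.factorial * qStirling (a : ℚ) (w + 1) (m + 1)) *
          (m.factorial / h.factorial * qStirling (b : ℚ) (h + 1) (m + 1))) := by
  obtain ⟨c, hc⟩ := geom_pow_eq (geom_spec t) (a + b) M
  -- Since e^y - 1 is divisible by y, the remainder is divisible by y^M and does not reach y^h.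
  have hdvd : (X : ℚ⟦X⟧⟦X⟧) ^ M ∣ (const t * (expInner - 1) * (expOuter - 1)) ^ M :=
    pow_dvd_pow_of_dvd (Dvd.dvd.mul_left (X_dvd_iff.2 (by simp [constantCoeff_expOuter])) _) M
  have hrest : coeff₂ w h ((expInner ^ a * expOuter ^ b) *
      ((const t * (expInner - 1) * (expOuter - 1)) ^ M * c)) = 0 := by
    rw [coeff₂, X_pow_dvd_iff.1 ((hdvd.mul_right c).mul_left _) h hM, map_zero]
  have hsplit : (expInner * geom t) ^ a * (expOuter * geom t) ^ b =
      ∑ m ∈ range M, const ((a + b).multichoose m * t ^ m) *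
        (PowerSeries.C (PowerSeries.exp ℚ ^ a * (PowerSeries.exp ℚ - 1) ^ m) *
        PowerSeries.map PowerSeries.C (PowerSeries.exp ℚ ^ b * (PowerSeries.exp ℚ - 1) ^ m)) +
      (expInner ^ a * expOuter ^ b) * ((const t * (expInner - 1) * (expOuter - 1)) ^ M * c) := by
    have h1 : (expInner * geom t) ^ a * (expOuter * geom t) ^ b =
        expInner ^ a * expOuter ^ b * geom t ^ (a + b) := by ring
    rw [h1, hc, mul_add, mul_sum]
    congr 1
    refine sum_congr rfl fun m _ => ?_
    have h2 : const ((a + b).multichoose m * t ^ m) = (a + b).multichoose m * const t ^ m := by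
      simp [const]
    rw [h2]
    simp only [map_mul, map_pow, map_sub, map_one]
    change _ = _ * (expInner ^ a * (expInner - 1) ^ m * (expOuter ^ b * (expOuter - 1) ^ m))
    rw [mul_pow (const t * (expInner - 1)), mul_pow (const t)]
    ring
  have hadd : ∀ f g, coeff₂ w h (f + g) = coeff₂ w h f + coeff₂ w h g := fun f g => by
    simp [coeff₂]
  have hsum : ∀ F : ℕ → ℚ⟦X⟧⟦X⟧, coeff₂ w h (∑ m ∈ range M, F m) =
      ∑ m ∈ range M, coeff₂ w h (F m) := fun F => by
    simp [coeff₂]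
  rw [hsplit, hadd, hrest, add_zero, hsum]
  refine sum_congr rfl fun m _ => ?_
  rw [coeff₂_const_mul, coeff₂_C_mul_map_C, coeff_exp_pow_mul, coeff_exp_pow_mul]

end GeneratingSeries

/-! ### From series back to trees, and from natural numbers to arbitrary semirings. -/

section Trees

theorem mem_treesOfSize {w h : ℕ} {T : Tree} : T ∈ treesOfSize w h ↔ T.shape ≠ .nil ∧
    (children Side.left T.shape).card = w ∧ (children Side.right T.shape).card = h := by
  rw [treesOfSize, Set.Finite.mem_toFinset]
  rfl

theorem card_treesOfSize_shape {w h : ℕ} {B : BinaryTree Unit} (hB : B ∈ shapeSet w h) :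
    ((treesOfSize w h).filter fun T => T.shape = B).card =
      linExt IsAncestor (children .left B) * linExt IsAncestor (children .right B) := by
  rw [← card_sideLabelling, ← card_sideLabelling, ← Nat.card_prod, ← Fintype.card_coe,
    ← Nat.card_eq_fintype_card]
  symm
  refine Nat.card_congr (Equiv.ofBijective (fun x => ⟨⟨B, x.1, x.2⟩,
    mem_filter.2 ⟨mem_treesOfSize.2 (mem_shapeSet.1 hB), rfl⟩⟩) ⟨?_, ?_⟩)
  · rintro ⟨L, R⟩ ⟨L', R'⟩ h
    have h := congrArg Subtype.val h
    cases h
    rfl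
  · rintro ⟨⟨B', L, R⟩, h⟩
    obtain rfl : B' = B := (mem_filter.1 h).2
    exact ⟨(L, R), rfl⟩

theorem sum_treesOfSize {M : Type*} [AddCommMonoid M] (w h : ℕ) (F : BinaryTree Unit → M) :
    ∑ T ∈ treesOfSize w h, F T.shape = ∑ B ∈ shapeSet w h,
      (linExt IsAncestor (children .left B) * linExt IsAncestor (children .right B)) • F B := by
  rw [← sum_fiberwise_of_maps_to (s := treesOfSize w h) (t := shapeSet w h) (g := Tree.shape)
    fun T hT => mem_shapeSet.2 (mem_treesOfSize.1 hT)]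
  refine sum_congr rfl fun B hB => ?_
  rw [← card_treesOfSize_shape hB, ← sum_const]
  exact sum_congr rfl fun T hT => by rw [(mem_filter.1 hT).2]

theorem factorial_mul_multichoose (N m : ℕ) :
    (m.factorial * N.multichoose m : ℚ) = (ascPochhammer ℚ m).eval (N : ℚ) := by
  rw [← ascPochhammer_eval_cast, ascPochhammer_nat_eq_ascFactorial,
    Nat.ascFactorial_eq_factorial_mul_choose', Nat.multichoose_eq]
  push_cast
  rfl

/-- Grouping trees by shape and undoing the division by w! h! reads off one coefficient of the
series. Of the two factors m! left over, one turns `multichoose` into the rising factorial. -/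
theorem sum_pow_hookNumber (t : ℚ) (a b w h M : ℕ) (hM : h < M) :
    ∑ T ∈ treesOfSize w h, t ^ hookNumber T.shape * weight (a : ℚ) (b : ℚ) T =
      ∑ m ∈ range M, t ^ (m + 1) * summand (a : ℚ) (b : ℚ) w h (m + 1) := by
  have hw : (w.factorial : ℚ) ≠ 0 := by positivity
  have hh : (h.factorial : ℚ) ≠ 0 := by positivity
  have h1 : ∑ T ∈ treesOfSize w h, t ^ hookNumber T.shape * weight (a : ℚ) (b : ℚ) T =
      w.factorial * h.factorial * ∑ B ∈ shapeSet w h, shapeWeight t none a b B := by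
    simp only [weight]
    rw [sum_treesOfSize w h fun B => t ^ hookNumber B *
      ((a : ℚ) ^ rootBranchCount .left B * (b : ℚ) ^ rootBranchCount .right B), mul_sum]
    refine sum_congr rfl fun B hB => ?_
    obtain ⟨-, hi, hj⟩ := mem_shapeSet.1 hB
    rw [shapeWeight, labelDensity, hi, hj, hookNumber_eq, nsmul_eq_mul]
    push_cast
    field_simp
  rw [h1, ← coeff₂_shapeSeries, shapeSeries_eq, mul_assoc (const t), coeff₂_const_mul,
    coeff₂_closed t a b w h M hM, mul_sum, mul_sum]
  refine sum_congr rfl fun m _ => ?_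
  rw [summand, Nat.add_sub_cancel, ← Nat.cast_add a b, ← factorial_mul_multichoose]
  field_simp
  ring

/-- Both sides of `sum_pow_hookNumber` are polynomials in t that agree at every rational number, so
their coefficients at t^p agree. -/
theorem sum_weight_natCast (a b w h : ℕ) {p : ℕ} (hp : 1 ≤ p) :
    ∑ T ∈ treesOfSize w h with hookNumber T.shape = p, weight (a : ℚ) (b : ℚ) T =
      summand (a : ℚ) (b : ℚ) w h p := by
  have key : ∑ T ∈ treesOfSize w h,
        Polynomial.X ^ hookNumber T.shape * Polynomial.C (weight (a : ℚ) (b : ℚ) T) =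
      -- The bound `h + p` exceeds `h`, as the expansion requires, and the range contains `p - 1`.
      ∑ m ∈ range (h + p), Polynomial.X ^ (m + 1) *
        Polynomial.C (summand (a : ℚ) (b : ℚ) w h (m + 1)) := by
    refine Polynomial.funext fun t => ?_
    simp only [Polynomial.eval_finsetSum, Polynomial.eval_mul, Polynomial.eval_pow,
      Polynomial.eval_X, Polynomial.eval_C]
    exact sum_pow_hookNumber t a b w h (h + p) (by omega)
  have h1 := congrArg (fun P => Polynomial.coeff P p) key
  simp only [Polynomial.finsetSum_coeff, Polynomial.coeff_mul_C, Polynomial.coeff_X_pow,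
    ite_mul, one_mul, zero_mul] at h1
  rw [sum_filter]
  simp only [eq_comm (a := p)] at h1
  rw [h1]
  obtain ⟨p, rfl⟩ : ∃ k, p = k + 1 := ⟨p - 1, by omega⟩
  rw [sum_eq_single p]
  · simp
  · intro m _ hm
    rw [if_neg (by omega)]
  · intro hm
    exact absurd (mem_range.2 (by omega)) hm

section Map

variable {R R' : Type*} [CommSemiring R] [CommSemiring R'] (φ : R →+* R') (α β : R)

theorem map_weight (T : Tree) : φ (weight α β T) = weight (φ α) (φ β) T := by
  simp [weight]

theorem map_summand (w h p : ℕ) : φ (summand α β w h p) = summand (φ α) (φ β) w h p := by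
  simp only [summand, map_mul, map_natCast, map_qStirling]
  rw [← ascPochhammer_map φ, Polynomial.eval_map, ← map_add, Polynomial.eval₂_at_apply]

end Map

/-- Over ℚ, two polynomials that agree on the infinite grid of pairs of natural numbers are equal,
and polynomials over ℕ embed in those over ℚ. -/
theorem sum_weight_X (w h : ℕ) {p : ℕ} (hp : 1 ≤ p) :
    ∑ T ∈ treesOfSize w h with hookNumber T.shape = p,
        weight (MvPolynomial.X 0 : MvPolynomial (Fin 2) ℕ) (MvPolynomial.X 1) T =
      summand (MvPolynomial.X 0) (MvPolynomial.X 1) w h p := by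
  refine MvPolynomial.map_injective (Nat.castRingHom ℚ) Nat.cast_injective ?_
  rw [map_sum]
  simp only [map_weight, map_summand, MvPolynomial.map_X]
  refine MvPolynomial.funext_set (fun _ => Set.range (Nat.cast : ℕ → ℚ))
    (fun _ => Set.infinite_range_of_injective Nat.cast_injective) fun x hx => ?_
  obtain ⟨a, ha⟩ := hx 0 (Set.mem_univ _)
  obtain ⟨b, hb⟩ := hx 1 (Set.mem_univ _)
  rw [map_sum]
  simp only [map_weight, map_summand, MvPolynomial.eval_X, ← ha, ← hb]
  exact sum_weight_natCast a b w h hp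

/-- Weights and summands commute with semiring homomorphisms, so the identity for indeterminates can
be evaluated at α and β. -/
theorem sum_weight_hookNumber {R : Type*} [CommSemiring R] (α β : R) (w h : ℕ) {p : ℕ}
    (hp : 1 ≤ p) :
    ∑ T ∈ treesOfSize w h with hookNumber T.shape = p, weight α β T = summand α β w h p := by
  have h1 := congrArg (MvPolynomial.eval₂Hom (Nat.castRingHom R) ![α, β]) (sum_weight_X w h hp)
  rw [map_sum] at h1
  simpa only [map_weight, map_summand, MvPolynomial.coe_eval₂Hom, MvPolynomial.eval₂_X,
    Matrix.cons_val_zero, Matrix.cons_val_one] using h1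

theorem summand_eq_zero {R : Type*} [CommSemiring R] (α β : R) {w h p : ℕ} (hp : w + 1 < p) :
    summand α β w h p = 0 := by
  rw [summand, qStirling_eq_zero α hp, zero_mul, mul_zero]

theorem one_le_hookNumber {B : BinaryTree Unit} (hB : B ≠ .nil) : 1 ≤ hookNumber B := by
  rw [hookNumber_eq]
  cases B with
  | nil => exact absurd rfl hB
  | node a l r =>
    rw [hookStarts, if_pos rfl]
    omega

end Trees

end NonAmbiguous

theorem mainTheorem1 {R : Type*} [CommSemiring R] (α β : R) (w h : ℕ) :
    {p : ℕ | 1 ≤ p ∧ NonAmbiguous.summand α β w h p ≠ 0}.Finite ∧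
    ∑ T ∈ NonAmbiguous.treesOfSize w h, NonAmbiguous.weight α β T =
      ∑ᶠ (p : ℕ) (_ : 1 ≤ p), NonAmbiguous.summand α β w h p ∧
    ∀ p : ℕ, 1 ≤ p →
      ∑ T ∈ NonAmbiguous.treesOfSize w h with NonAmbiguous.hookNumber T.shape = p,
          NonAmbiguous.weight α β T =
        NonAmbiguous.summand α β w h p := by
  have hle : ∀ p, NonAmbiguous.summand α β w h p ≠ 0 → p ≤ w + 1 := fun p hp =>
    not_lt.1 fun hlt => hp (NonAmbiguous.summand_eq_zero α β hlt)
  refine ⟨(Set.finite_Iic (w + 1)).subset fun p hp => hle p hp.2, ?_,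
    fun p hp => NonAmbiguous.sum_weight_hookNumber α β w h hp⟩
  -- The interval catches all non-zero summands and the image all hook numbers that occur; taking
  -- the union avoids comparing the two.
  set I : Finset ℕ := Finset.Icc 1 (w + 1) ∪
    (NonAmbiguous.treesOfSize w h).image fun T => NonAmbiguous.hookNumber T.shape with hI
  have hI1 : ∀ p ∈ I, 1 ≤ p := by
    intro p hp
    rcases Finset.mem_union.1 hp with hp | hp
    · exact (Finset.mem_Icc.1 hp).1
    · obtain ⟨T, hT, rfl⟩ := Finset.mem_image.1 hp
      exact NonAmbiguous.one_le_hookNumber (NonAmbiguous.mem_treesOfSize.1 hT).1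
  have hfin : ∑ᶠ (p : ℕ) (_ : 1 ≤ p), NonAmbiguous.summand α β w h p =
      ∑ p ∈ I, NonAmbiguous.summand α β w h p := by
    refine finsum_mem_eq_sum_of_inter_support_eq (s := {p | 1 ≤ p}) _ ?_
    ext p
    constructor
    · rintro ⟨h1, h2⟩
      exact ⟨Finset.mem_union_left _ (Finset.mem_Icc.2 ⟨h1, hle p h2⟩), h2⟩
    · rintro ⟨h1, h2⟩
      exact ⟨hI1 p h1, h2⟩
  rw [hfin, ← Finset.sum_fiberwise_of_maps_to (s := NonAmbiguous.treesOfSize w h) (t := I)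
    (g := fun T => NonAmbiguous.hookNumber T.shape)
    fun T hT => Finset.mem_union_right _ (Finset.mem_image_of_mem _ hT)]
  exact Finset.sum_congr rfl fun p hp =>
    NonAmbiguous.sum_weight_hookNumber α β w h (hI1 p hp)
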